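/- Let $\beta\ge 2$ be an even integer, let $a\ge 0$ and $x$ be real numbers. For an integer $N\ge 1$ let \[ f(u,t)=4tu-\ln u+\ln(1-u)+\frac1N\Big(a-2+\frac2\beta\Big)\ln(1-u) \] (principal logarithms) and, with $\mathcal C$ the unit circle traversed once counterclockwise from $u=1$ to $u=1$, let \[ R_{N,\beta}(t)=\int_{\mathcal C}du_1\,e^{Nf(u_1,t)}\cdots\int_{\mathcal C}du_\beta\,e^{Nf(u_\beta,t)}\prod_{1\le j<k\le\beta}|u_j-u_k|^{4/\beta}\qquad(t\in\mathbb R). \] Further let \[ K_{\beta,\beta}(x)=\lim_{c\to0^+}\frac{1}{(2\pi \mathrm i)^\beta}\int_{c-\mathrm i\infty}^{c+\mathrm i\infty}dv_1\cdots\int_{c-\mathrm i\infty}^{c+\mathrm i\infty}dv_\beta\prod_{j=1}^\beta e^{v_j^3/3-xv_j}\prod_{1\le j<k\le\beta}|v_j-v_k|^{4/\beta}. \] Then the integral defining $R_{N,\beta}(t)$ converges absolutely for all $N\ge1$ and all real $t$; the integral defining $K_{\beta,\beta}(x)$ converges absolutely for every $c>0$, and $(2\pi\mathrm i)^{-\beta}$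 times it equals $K_{\beta,\beta}(x)$ for every $c>0$; and, for fixed $\beta,a,x$, as $N\to\infty$ through the integers, \[ R_{N,\beta}\Big(1+\frac{x}{(2N)^{2/3}}\Big)=(2\pi\mathrm i)^\beta\,\frac{e^{2\beta N+\beta(2N)^{1/3}x}}{2^{a\beta+4/3}N^{\beta-2/3}}\,K_{\beta,\beta}(x)+\mathrm O\Big(e^{2\beta N+\beta(2N)^{1/3}x}\,N^{-\beta+1/3}\Big). \] -/

import Mathlib

open Filter Topology MeasureTheory

noncomputable section

/-- The interaction factor `∏_{j<k} |z_j - z_k|^{4/β}` of `β` complex variables. -/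
def interaction (β : ℕ) (z : Fin β → ℂ) : ℝ :=
  ∏ j : Fin β, ∏ k ∈ Finset.Ioi j, ‖z j - z k‖ ^ (4 / (β : ℝ))

/-- The integrand `∏_j e^{N f(u_j,x)} ∏_{j<k} |u_j - u_k|^{4/β}`. -/
def rIntegrand (f : ℂ → ℝ → ℂ) (N β : ℕ) (x : ℝ) (u : Fin β → ℂ) : ℂ :=
  (∏ j : Fin β, Complex.exp ((N : ℂ) * f (u j) x)) * (interaction β u : ℂ)

/-- `R_{N,β}(x)`, each variable running once counterclockwise around the unit circle, from
`u = 1` back to `u = 1`. (`torusIntegral` is the iterated contour integral, with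
`du_j = i e^{iθ_j} dθ_j`, `0 ≤ θ_j ≤ 2π`.) -/
def rIntegral (f : ℂ → ℝ → ℂ) (N β : ℕ) (x : ℝ) : ℂ :=
  torusIntegral (rIntegrand f N β x) (fun _ => 0) (fun _ => 1)

/-- The Laguerre function
`f(u,x) = 4xu - ln u + ln(1-u) + (1/N)(a - 2 + 2/β) ln(1-u)` (principal logarithms; the choice
of the branch of `ln u` does not affect `e^{N f(u,x)}`). -/
def laguerreF (a : ℝ) (N β : ℕ) (u : ℂ) (x : ℝ) : ℂ :=
  4 * (x : ℂ) * u - Complex.log u + Complex.log (1 - u)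
    + (1 / (N : ℂ)) * ((a : ℂ) - 2 + 2 / (β : ℂ)) * Complex.log (1 - u)

/-- The integrand `∏_j e^{v_j³/3 - x v_j} ∏_{j<k} |v_j - v_k|^{4/β}`. -/
def kontsevichIntegrand (β : ℕ) (x : ℝ) (v : Fin β → ℂ) : ℂ :=
  (∏ j : Fin β, Complex.exp (v j ^ 3 / 3 - (x : ℂ) * v j)) * (interaction β v : ℂ)

/-- The point `(c + i y_1, …, c + i y_β)`, all coordinates on the vertical line `Re v = c`. -/
def verticalPoint (β : ℕ) (c : ℝ) (y : Fin β → ℝ) : Fin β → ℂ :=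
  fun j => (c : ℂ) + (y j : ℂ) * Complex.I

/-- `(2πi)^{-β} ∫_{c-i∞}^{c+i∞} dv_1 ⋯ ∫_{c-i∞}^{c+i∞} dv_β` of the integrand above,
with `dv_j = i dy_j`. -/
def kontsevichLine (β : ℕ) (c x : ℝ) : ℂ :=
  1 / (2 * (Real.pi : ℂ) * Complex.I) ^ β *
    ∫ y : Fin β → ℝ, Complex.I ^ β * kontsevichIntegrand β x (verticalPoint β c y)

/-- `K_{β,β}(x)`, the Kontsevich type integral along the imaginary axis. On the axis itself the
integrand is of constant modulus up to a growing factor, so the integral is taken in the usual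
regularized sense: the line of integration is approached from the right, where the integral
converges absolutely. -/
def kontsevichK (β : ℕ) (x : ℝ) : ℂ :=
  limUnder (𝓝[>] (0 : ℝ)) (fun c => kontsevichLine β c x)

end

/-!
The interaction `∏ |u_j - u_k| ^ (4/β)` is not holomorphic, so the contours cannot be deformed one
variable at a time. It is, however, invariant under rotating all points of a circle together and
under translating all points of a line together, and this is enough to move all contours at once.

*Circles.* With the interaction evaluated at the angles, the integral over `|u_j| = r` is the
integral over the torus of `∏ h (ζ e^{iθ_j}) · ∏ |e^{iθ_j} - e^{iθ_k}| ^ (4/β)` at `ζ = r`, where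
`h u = u e^{N f(u,t)}`. It is holomorphic in `log ζ` and, by invariance of the Haar measure of the
torus, independent of `arg ζ`; hence it is constant for `0 < |ζ| < 1`
(`integral_torusIntegrand_exp_eq`), and dominated convergence carries this to `|ζ| = 1`
(`integral_torusIntegrand_circleWeight`). The same argument, with translations in place of
rotations, shows that the Kontsevich type integral over `Re v = c` does not depend on `c > 0`
(`integral_airyShift_eq`). Both use `eq_of_imaginary_translation_invariant`.

*The saddle point.* The exponent `4u - ln u + ln (1 - u)` has a double saddle point at `u = 1/2`.
Put `m = (2N)^{1/3}` and parametrize the circle of radius `e^{-1/m}/2` by `u = e^{-w/m}/2`,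
`w = 1 + iy`, `|y| ≤ π m`. In the variable `z = w/m` the phase `q` satisfies
`q'(z) = (1 - e^{-z})² / (2 - e^{-z})`, which gives `q(z) = 1 + z³/3 + O(|z|⁴)` on the whole right
half-plane (`norm_saddlePhase_sub_le`), so that the exponent is that of the Airy factor
`e^{w³/3 - xw}` up to `O(1/m)`. Because the radius is less than `1/2` by an amount of order `1/m`,
the rescaled factor decays like a Gaussian in `y` uniformly in `m` (`re_saddlePhase_le`,
`re_scaledExponent_le`). Chords divided by arcs contribute a further relative error `O(1/m)` in the
interaction (`abs_interaction_chord_sub_le`). Comparing the two products under a common integrable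
majorant yields `norm_integral_scaled_sub_le`, and `1/m = (2N)^{-1/3}` is the claimed relative
error.
-/

/-! ### Contour shifts for translation-invariant weights -/

/-- An integral depending holomorphically on a parameter is differentiable at the centre of a ball
on which the integrand has an integrable majorant: by Cauchy's estimate the majorant also controls
the derivative. -/
theorem differentiableAt_integral_of_dominated_ball {α : Type*} [MeasurableSpace α]
    {μ : Measure α} {F : ℂ → α → ℂ} {B : α → ℝ} {w₀ : ℂ} {r : ℝ} (hr : 0 < r)
    (hB : Integrable B μ) (hmeas : ∀ w, AEStronglyMeasurable (F w) μ)
    (hdiff : ∀ a, DifferentiableOn ℂ (fun w => F w a) (Metric.ball w₀ r))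
    (hle : ∀ w ∈ Metric.ball w₀ r, ∀ a, ‖F w a‖ ≤ B a) :
    DifferentiableAt ℂ (fun w => ∫ a, F w a ∂μ) w₀ := by
  have hderiv : ∀ a, ∀ w ∈ Metric.ball w₀ (r / 2),
      HasDerivAt (fun w => F w a) (deriv (fun w => F w a) w) w := by
    intro a w hw
    refine ((hdiff a).differentiableAt ?_).hasDerivAt
    exact Metric.isOpen_ball.mem_nhds (Metric.ball_subset_ball (by linarith) hw)
  have hw₀ : w₀ ∈ Metric.ball w₀ (r / 2) := Metric.mem_ball_self (by linarith)
  refine (hasDerivAt_integral_of_dominated_loc_of_deriv_le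
    (F' := fun w a => deriv (fun w => F w a) w) (bound := fun a => B a / (r / 4))
    (Metric.ball_mem_nhds w₀ (half_pos hr)) (Eventually.of_forall hmeas)
    (hB.mono' (hmeas w₀) (Eventually.of_forall fun a => hle w₀ (Metric.mem_ball_self hr) a))
    ?_ (Eventually.of_forall ?_) (hB.div_const _) (Eventually.of_forall hderiv)).2.differentiableAt
  · -- the derivative is a pointwise limit of difference quotients
    have hseq : Tendsto (fun n : ℕ => w₀ + 1 / ((n : ℂ) + 1)) atTop (𝓝[≠] w₀) := by
      refine tendsto_nhdsWithin_iff.2 ⟨?_, Eventually.of_forall fun n => ?_⟩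
      · simpa using (tendsto_one_div_add_atTop_nhds_zero_nat (𝕜 := ℂ)).const_add w₀
      · have : ((n : ℂ) + 1) ≠ 0 := Nat.cast_add_one_ne_zero n
        simp [this]
    refine aestronglyMeasurable_of_tendsto_ae atTop
      (f := fun (n : ℕ) a => slope (fun w => F w a) w₀ (w₀ + 1 / ((n : ℂ) + 1))) (fun n => ?_)
      (Eventually.of_forall fun a => ?_)
    · have hs := ((hmeas (w₀ + 1 / ((n : ℂ) + 1))).sub (hmeas w₀)).const_smul
        (w₀ + 1 / ((n : ℂ) + 1) - w₀)⁻¹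
      exact hs
    · exact (hasDerivAt_iff_tendsto_slope.1 (hderiv a w₀ hw₀)).comp hseq
  · intro a w hw
    have hball : Metric.closedBall w (r / 4) ⊆ Metric.ball w₀ r := by
      refine (Metric.closedBall_subset_ball' ?_ : _ ⊆ Metric.ball w₀ r)
      have := Metric.mem_ball.1 hw
      linarith
    refine Complex.norm_deriv_le_of_forall_mem_sphere_norm_le (by linarith) ?_
      fun z hz => hle z (hball (Metric.sphere_subset_closedBall hz)) a
    refine DifferentiableOn.diffContOnCl ((hdiff a).mono ?_)
    rw [closure_ball _ (by linarith)]
    exact hball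

/-- A function holomorphic on a convex open set and invariant under imaginary translations is
constant there. -/
theorem eq_of_imaginary_translation_invariant {H : ℂ → ℂ} {U : Set ℂ} (hU : Convex ℝ U)
    (hd : ∀ w ∈ U, DifferentiableAt ℂ H w)
    (hinv : ∀ w (s : ℝ), H (w + s * Complex.I) = H w) {w z : ℂ} (hw : w ∈ U) (hz : z ∈ U) :
    H w = H z := by
  have hderiv : ∀ w ∈ U, HasDerivAt H 0 w := by
    intro w hw
    have h1 : HasDerivAt (fun s : ℝ => w + (s : ℂ) * Complex.I) (1 * Complex.I) 0 :=
      ((Complex.ofRealCLM.hasDerivAt (x := (0 : ℝ))).mul_const Complex.I).const_add w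
    have hHw : HasDerivAt H (deriv H w) (w + ((0 : ℝ) : ℂ) * Complex.I) := by
      simpa using (hd w hw).hasDerivAt
    have h2 := hHw.scomp (0 : ℝ) h1
    have h3 : (H ∘ fun s : ℝ => w + (s : ℂ) * Complex.I) = fun _ => H w :=
      funext fun s => hinv w s
    rw [h3] at h2
    have h4 := h2.unique (hasDerivAt_const (0 : ℝ) (H w))
    have h5 : deriv H w = 0 := by simpa using h4
    exact h5 ▸ (hd w hw).hasDerivAt
  have := hU.norm_image_sub_le_of_norm_hasDerivWithin_le (C := 0)
    (fun w hw => (hderiv w hw).hasDerivWithinAt) (fun w _ => by simp) hz hw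
  simpa [sub_eq_zero] using this

/-! ### Comparing finite products -/

/-- If the factors of two products have common majorants `A i` and differ by at most `η * A i`,
the products differ by at most `card * η * ∏ A i`. -/
theorem norm_prod_sub_prod_le {ι R : Type*} [NormedCommRing R] [NormOneClass R]
    (s : Finset ι) (a b : ι → R) (A : ι → ℝ) {η : ℝ} (hη : 0 ≤ η)
    (ha : ∀ i ∈ s, ‖a i‖ ≤ A i) (hb : ∀ i ∈ s, ‖b i‖ ≤ A i)
    (hab : ∀ i ∈ s, ‖a i - b i‖ ≤ η * A i) :
    ‖∏ i ∈ s, a i - ∏ i ∈ s, b i‖ ≤ s.card * η * ∏ i ∈ s, A i := by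
  classical
  induction s using Finset.induction_on with
  | empty => simp
  | insert i s hi ih =>
    simp only [Finset.forall_mem_insert] at ha hb hab
    have hA : 0 ≤ A i := (norm_nonneg _).trans ha.1
    have hAs : 0 ≤ ∏ j ∈ s, A j :=
      Finset.prod_nonneg fun j hj => (norm_nonneg _).trans (ha.2 j hj)
    rw [Finset.prod_insert hi, Finset.prod_insert hi, Finset.prod_insert hi,
      Finset.card_insert_of_notMem hi]
    have hP : ‖∏ j ∈ s, a j‖ ≤ ∏ j ∈ s, A j :=
      (Finset.norm_prod_le _ _).trans (Finset.prod_le_prod (fun _ _ => norm_nonneg _) ha.2)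
    calc ‖a i * ∏ j ∈ s, a j - b i * ∏ j ∈ s, b j‖
        = ‖(a i - b i) * ∏ j ∈ s, a j + b i * (∏ j ∈ s, a j - ∏ j ∈ s, b j)‖ := by
          congr 1; ring
      _ ≤ ‖a i - b i‖ * ‖∏ j ∈ s, a j‖ + ‖b i‖ * ‖∏ j ∈ s, a j - ∏ j ∈ s, b j‖ :=
          (norm_add_le _ _).trans (add_le_add (norm_mul_le _ _) (norm_mul_le _ _))
      _ ≤ (η * A i) * ∏ j ∈ s, A j + A i * (s.card * η * ∏ j ∈ s, A j) := by
          gcongr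
          · exact hab.1
          · exact hb.1
          · exact ih ha.2 hb.2 hab.2
      _ = _ := by push_cast; ring

/-! ### Integrals over a torus -/

instance fact_two_pi_pos : Fact (0 < 2 * Real.pi) := ⟨Real.two_pi_pos⟩

/-- The point of the unit circle in `ℂ` corresponding to an angle modulo `2π`. -/
noncomputable def angleToCircle (x : AddCircle (2 * Real.pi)) : ℂ := (AddCircle.toCircle x : ℂ)

theorem continuous_angleToCircle : Continuous angleToCircle :=
  continuous_subtype_val.comp AddCircle.continuous_toCircle

theorem angleToCircle_coe (θ : ℝ) :
    angleToCircle (θ : AddCircle (2 * Real.pi)) = Complex.exp (θ * Complex.I) := by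
  rw [angleToCircle, AddCircle.toCircle_apply_mk, Circle.coe_exp, div_self Real.two_pi_pos.ne',
    one_mul]

theorem angleToCircle_add (x y : AddCircle (2 * Real.pi)) :
    angleToCircle (x + y) = angleToCircle x * angleToCircle y := by
  simp [angleToCircle, AddCircle.toCircle_add]

theorem norm_angleToCircle (x : AddCircle (2 * Real.pi)) : ‖angleToCircle x‖ = 1 := by
  exact Circle.norm_coe _

/-- A box with sides of length `2π` parametrizes the torus, wherever its corner is. -/
theorem setIntegral_box_eq_integral_torus {n : ℕ} {G : (Fin n → ℂ) → ℂ} (hG : Measurable G)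
    (a : ℝ) :
    ∫ θ in Set.Icc (fun _ : Fin n => a) (fun _ => a + 2 * Real.pi),
        G (fun i => Complex.exp (θ i * Complex.I))
      = ∫ x : Fin n → AddCircle (2 * Real.pi), G (fun i => angleToCircle (x i)) := by
  have hmp := measurePreserving_pi (fun _ : Fin n => volume.restrict (Set.Ioc a (a + 2 * Real.pi)))
    (fun _ : Fin n => (volume : Measure (AddCircle (2 * Real.pi))))
    (fun _ => AddCircle.measurePreserving_mk (2 * Real.pi) a)
  have hmeas : Measurable fun x : Fin n → AddCircle (2 * Real.pi) =>
      G (fun i => angleToCircle (x i)) := by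
    refine hG.comp (measurable_pi_lambda _ fun i => ?_)
    exact continuous_angleToCircle.measurable.comp (measurable_pi_apply i)
  rw [volume_pi (α := fun _ : Fin n => AddCircle (2 * Real.pi)), ← hmp.map_eq,
    integral_map hmp.measurable.aemeasurable hmeas.aestronglyMeasurable, ← Measure.restrict_pi_pi,
    Measure.restrict_congr_set
      (Measure.univ_pi_Ioc_ae_eq_Icc (f := fun _ : Fin n => a)
        (g := fun _ => a + 2 * Real.pi))]
  simp only [angleToCircle_coe]
  rfl

/-! ### The interaction factor -/

theorem interaction_nonneg (β : ℕ) (z : Fin β → ℂ) : 0 ≤ interaction β z :=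
  Finset.prod_nonneg fun _ _ => Finset.prod_nonneg fun _ _ => Real.rpow_nonneg (norm_nonneg _) _

theorem continuous_interaction (β : ℕ) : Continuous (interaction β) := by
  refine continuous_finsetProd _ fun j _ => continuous_finsetProd _ fun k _ => ?_
  refine Continuous.rpow_const (by fun_prop) fun z => Or.inr (by positivity)

theorem interaction_congr {β : ℕ} {z z' : Fin β → ℂ}
    (h : ∀ j k, ‖z j - z k‖ = ‖z' j - z' k‖) : interaction β z = interaction β z' := by
  simp only [interaction, h]

theorem interaction_smul_of_norm_eq_one {β : ℕ} {ζ : ℂ} (hζ : ‖ζ‖ = 1) (z : Fin β → ℂ) :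
    interaction β (fun j => ζ * z j) = interaction β z :=
  interaction_congr fun j k => by rw [← mul_sub, norm_mul, hζ, one_mul]

theorem interaction_add_const {β : ℕ} (s : ℂ) (z : Fin β → ℂ) :
    interaction β (fun j => s + z j) = interaction β z :=
  interaction_congr fun j k => by rw [add_sub_add_left_eq_sub]

/-- The polynomial weight `∏ (1 + |y_i|)` in which the growth of the interaction is measured. -/
noncomputable def polyWeight {n : ℕ} (y : Fin n → ℝ) : ℝ := ∏ i, (1 + |y i|)

theorem one_le_polyWeight {n : ℕ} (y : Fin n → ℝ) : 1 ≤ polyWeight y := by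
  have h : ∀ i ∈ (Finset.univ : Finset (Fin n)), 1 ≤ 1 + |y i| := fun i _ => by simp
  simpa [polyWeight] using Finset.prod_le_prod (fun _ _ => zero_le_one) h

theorem one_add_abs_le_polyWeight {n : ℕ} (y : Fin n → ℝ) (i : Fin n) :
    1 + |y i| ≤ polyWeight y := by
  rw [polyWeight, ← Finset.mul_prod_erase _ _ (Finset.mem_univ i)]
  refine le_mul_of_one_le_right (by positivity) ?_
  have h : ∀ j ∈ Finset.univ.erase i, 1 ≤ 1 + |y j| := fun j _ => by simp
  simpa using Finset.prod_le_prod (fun _ _ => zero_le_one) h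

theorem abs_sub_le_polyWeight_sq {n : ℕ} (y : Fin n → ℝ) (j k : Fin n) :
    |y j - y k| ≤ polyWeight y ^ 2 := by
  have hj := one_add_abs_le_polyWeight y j
  have hk := one_add_abs_le_polyWeight y k
  have := abs_sub (y j) (y k)
  have h1 := one_le_polyWeight y
  nlinarith [abs_nonneg (y j), abs_nonneg (y k)]

/-- Six times the number of pairs `j < k`: a power of `polyWeight` that dominates the interaction.
Distances are at most `polyWeight ^ 2`, so each factor `|y_j - y_k| ^ (4/β)` needs the power `4`,
and one more factor `|y_j - y_k|` in the error terms makes it `6`. -/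
def interactionDegree (β : ℕ) : ℕ := ∑ j : Fin β, ∑ _k ∈ Finset.Ioi j, 6

theorem prod_pairs_pow (β : ℕ) (T : ℝ) :
    ∏ j : Fin β, ∏ _k ∈ Finset.Ioi j, T ^ 6 = T ^ interactionDegree β := by
  simp only [interactionDegree, Finset.prod_pow_eq_pow_sum]

theorem rpow_le_pow_six {T b g : ℝ} (hT : 1 ≤ T) (hb : 0 ≤ b) (hbT : b ≤ T ^ 2) (hg0 : 0 ≤ g)
    (hg : g ≤ 2) : b ^ g ≤ T ^ 6 := by
  have hT2 : 1 ≤ T ^ 2 := one_le_pow₀ hT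
  calc b ^ g ≤ (T ^ 2) ^ g := Real.rpow_le_rpow hb hbT hg0
    _ ≤ (T ^ 2) ^ (2 : ℝ) := Real.rpow_le_rpow_of_exponent_le hT2 hg
    _ = T ^ 4 := by rw [Real.rpow_two]; ring
    _ ≤ T ^ 6 := pow_le_pow_right₀ hT (by norm_num)

theorem four_div_le_two {β : ℕ} (hβ : 2 ≤ β) : 4 / (β : ℝ) ≤ 2 := by
  have : (2 : ℝ) ≤ β := by exact_mod_cast hβ
  rw [div_le_iff₀ (by linarith)]
  linarith

theorem interaction_le {β : ℕ} (hβ : 2 ≤ β) {z : Fin β → ℂ} {y : Fin β → ℝ}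
    (h : ∀ j k, ‖z j - z k‖ ≤ |y j - y k|) :
    interaction β z ≤ polyWeight y ^ interactionDegree β := by
  rw [← prod_pairs_pow]
  refine Finset.prod_le_prod (fun _ _ => Finset.prod_nonneg fun _ _ => by positivity)
    fun j _ => Finset.prod_le_prod (fun _ _ => by positivity) fun k _ => ?_
  exact rpow_le_pow_six (one_le_polyWeight y) (norm_nonneg _)
    ((h j k).trans (abs_sub_le_polyWeight_sq y j k)) (by positivity) (four_div_le_two hβ)

/-- If `b'` falls short of `b` by at most `η b²`, then `b' ^ g` falls short of `b ^ g` by at most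
`2 η b ^ g b`: with `s = b' / b`, one has `1 - s ^ g ≤ 1 - s ^ 2 ≤ 2 (1 - s)`. -/
theorem rpow_sub_rpow_le {b b' η g : ℝ} (hb' : 0 ≤ b') (hbb : b' ≤ b) (hη : b - b' ≤ η * b ^ 2)
    (hg0 : 0 ≤ g) (hg : g ≤ 2) : b ^ g - b' ^ g ≤ 2 * η * (b ^ g * b) := by
  rcases (hb'.trans hbb).eq_or_lt with hb | hb
  · have : b' = 0 := le_antisymm (hb ▸ hbb) hb'
    simp [this, ← hb]
  · set s := b' / b with hs
    have hs0 : 0 ≤ s := by positivity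
    have hs1 : s ≤ 1 := (div_le_one hb).2 hbb
    have hb's : b' = b * s := by rw [hs]; field_simp
    have h1 : s ^ (2 : ℝ) ≤ s ^ g := Real.rpow_le_rpow_of_exponent_ge' hs0 hs1 hg0 hg
    rw [Real.rpow_two] at h1
    have h2 : 1 - s ≤ η * b := by
      rw [hb's] at hη
      refine le_of_mul_le_mul_left ?_ hb
      nlinarith
    rw [hb's, Real.mul_rpow hb.le hs0]
    have h3 : 1 - s ^ g ≤ 2 * (η * b) := by nlinarith
    have h4 : 0 ≤ b ^ g := by positivity
    nlinarith

/-- Distances that are slightly too small, with relative error at most `η |y_j - y_k|`, change the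
interaction by at most `O(η)`, up to a polynomial factor. -/
theorem abs_interaction_sub_le {β : ℕ} (hβ : 2 ≤ β) {z z' : Fin β → ℂ} {y : Fin β → ℝ} {η : ℝ}
    (hη : 0 ≤ η) (hz : ∀ j k, ‖z j - z k‖ = |y j - y k|)
    (hz' : ∀ j k, ‖z' j - z' k‖ ≤ |y j - y k|)
    (hzz' : ∀ j k, |y j - y k| - ‖z' j - z' k‖ ≤ η * |y j - y k| ^ 2) :
    |interaction β z' - interaction β z|
      ≤ interactionDegree β * (2 * η) * polyWeight y ^ interactionDegree β := by
  have hT := one_le_polyWeight y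
  have key := norm_prod_sub_prod_le
    ((Finset.univ : Finset (Fin β)).sigma fun j => Finset.Ioi j)
    (fun p => ‖z' p.1 - z' p.2‖ ^ (4 / (β : ℝ))) (fun p => ‖z p.1 - z p.2‖ ^ (4 / (β : ℝ)))
    (fun _ => polyWeight y ^ 6) (η := 2 * η) (by positivity) ?_ ?_ ?_
  · rw [Finset.prod_sigma, Finset.prod_sigma, Finset.prod_sigma, prod_pairs_pow,
      Real.norm_eq_abs] at key
    refine key.trans ?_
    gcongr
    simp only [Finset.card_sigma, interactionDegree]
    refine Finset.sum_le_sum fun j _ => ?_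
    simp only [Finset.sum_const, smul_eq_mul]
    omega
  · rintro ⟨j, k⟩ -
    rw [Real.norm_of_nonneg (by positivity)]
    exact rpow_le_pow_six hT (norm_nonneg _) ((hz' j k).trans (abs_sub_le_polyWeight_sq y j k))
      (by positivity) (four_div_le_two hβ)
  · rintro ⟨j, k⟩ -
    rw [Real.norm_of_nonneg (by positivity)]
    exact rpow_le_pow_six hT (norm_nonneg _) ((hz j k).le.trans (abs_sub_le_polyWeight_sq y j k))
      (by positivity) (four_div_le_two hβ)
  · rintro ⟨j, k⟩ -
    have hmono : ‖z' j - z' k‖ ^ (4 / (β : ℝ)) ≤ |y j - y k| ^ (4 / (β : ℝ)) :=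
      Real.rpow_le_rpow (norm_nonneg _) (hz' j k) (by positivity)
    simp only [hz]
    rw [norm_sub_rev, Real.norm_of_nonneg (by linarith)]
    refine (rpow_sub_rpow_le (norm_nonneg _) (hz' j k) (hzz' j k) (by positivity)
      (four_div_le_two hβ)).trans ?_
    refine mul_le_mul_of_nonneg_left ?_ (by positivity)
    have hd := abs_sub_le_polyWeight_sq y j k
    have hT2 : 1 ≤ polyWeight y ^ 2 := one_le_pow₀ hT
    calc |y j - y k| ^ (4 / (β : ℝ)) * |y j - y k|
        ≤ (polyWeight y ^ 2) ^ (2 : ℝ) * polyWeight y ^ 2 := by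
          gcongr
          exact (Real.rpow_le_rpow (abs_nonneg _) hd (by positivity)).trans
            (Real.rpow_le_rpow_of_exponent_le hT2 (four_div_le_two hβ))
      _ = polyWeight y ^ 6 := by rw [Real.rpow_two]; ring

/-! ### Gaussian majorants -/

theorem one_add_abs_pow_mul_exp_le (D : ℕ) {κ : ℝ} (hκ : 0 < κ) (y : ℝ) :
    (1 + |y|) ^ D * Real.exp (-κ * y ^ 2)
      ≤ (D.factorial * Real.exp (1 + 1 / (2 * κ))) * Real.exp (-(κ / 2) * y ^ 2) := by
  have h1 : (1 + |y|) ^ D ≤ D.factorial * Real.exp (1 + |y|) := by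
    have := Real.pow_div_factorial_le_exp (1 + |y|) (by positivity) D
    rwa [div_le_iff₀ (by positivity), mul_comm] at this
  have h2 : |y| ≤ κ / 2 * y ^ 2 + 1 / (2 * κ) := by
    have h3 : κ / 2 * y ^ 2 + 1 / (2 * κ) - |y| = (κ * |y| - 1) ^ 2 / (2 * κ) := by
      rw [← sq_abs y]; field_simp; ring
    have h4 : 0 ≤ (κ * |y| - 1) ^ 2 / (2 * κ) := by positivity
    linarith
  calc (1 + |y|) ^ D * Real.exp (-κ * y ^ 2)
      ≤ D.factorial * Real.exp (1 + |y|) * Real.exp (-κ * y ^ 2) := by gcongr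
    _ = D.factorial * Real.exp (1 + |y| - κ * y ^ 2) := by
        rw [mul_assoc, ← Real.exp_add]; ring_nf
    _ ≤ D.factorial * Real.exp ((1 + 1 / (2 * κ)) + -(κ / 2) * y ^ 2) := by
        gcongr; linarith
    _ = _ := by rw [Real.exp_add]; ring

theorem integrable_one_add_abs_pow_mul_exp (D : ℕ) {κ : ℝ} (hκ : 0 < κ) :
    Integrable fun y : ℝ => (1 + |y|) ^ D * Real.exp (-κ * y ^ 2) := by
  refine ((integrable_exp_neg_mul_sq (half_pos hκ)).const_mul
    (D.factorial * Real.exp (1 + 1 / (2 * κ)))).mono' ?_ (Eventually.of_forall fun y => ?_)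
  · exact Continuous.aestronglyMeasurable (by fun_prop)
  · rw [Real.norm_of_nonneg (by positivity)]
    exact one_add_abs_pow_mul_exp_le D hκ y

/-- Products of one-dimensional Gaussian majorants stay integrable against any power of
`polyWeight`. -/
theorem integrable_prod_gaussian_mul_polyWeight {n : ℕ} (C : ℝ) (d D : ℕ) {κ : ℝ} (hκ : 0 < κ) :
    Integrable fun y : Fin n → ℝ =>
      (∏ i, C * ((1 + |y i|) ^ d * Real.exp (-κ * y i ^ 2))) * polyWeight y ^ D := by
  have h := Integrable.fintype_prod (μ := fun _ : Fin n => (volume : Measure ℝ))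
    (f := fun _ (y : ℝ) => C * ((1 + |y|) ^ (d + D) * Real.exp (-κ * y ^ 2)))
    (fun _ => (integrable_one_add_abs_pow_mul_exp (d + D) hκ).const_mul C)
  rw [← volume_pi] at h
  refine h.congr (Eventually.of_forall fun y => ?_)
  simp only [polyWeight, ← Finset.prod_pow, ← Finset.prod_mul_distrib]
  refine Finset.prod_congr rfl fun i _ => ?_
  ring

/-! ### The Kontsevich type integral -/

/-- The one-variable exponential factor `e^{v³/3 - x v}` of the Kontsevich type integral. -/
noncomputable def airyWeight (x : ℝ) (v : ℂ) : ℂ := Complex.exp (v ^ 3 / 3 - (x : ℂ) * v)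

theorem norm_airyWeight (x c y : ℝ) :
    ‖airyWeight x ((c : ℂ) + (y : ℂ) * Complex.I)‖
      = Real.exp (c ^ 3 / 3 - c * y ^ 2 - x * c) := by
  rw [airyWeight, Complex.norm_exp]
  congr 1
  have : ((c : ℂ) + (y : ℂ) * Complex.I) ^ 3 / 3 - (x : ℂ) * ((c : ℂ) + (y : ℂ) * Complex.I)
      = ((c ^ 3 / 3 - c * y ^ 2 - x * c : ℝ) : ℂ)
        + ((c ^ 2 * y - y ^ 3 / 3 - x * y : ℝ) : ℂ) * Complex.I := by
    push_cast
    linear_combination ((c : ℂ) * y ^ 2 + (y : ℂ) ^ 3 / 3 * Complex.I) * Complex.I_sq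
  rw [this, Complex.add_re, Complex.ofReal_re, Complex.re_ofReal_mul, Complex.I_re, mul_zero,
    add_zero]

/-- The integrand of the Kontsevich type integral with all variables translated by `w`. -/
noncomputable def airyShift (β : ℕ) (x : ℝ) (w : ℂ) (y : Fin β → ℝ) : ℂ :=
  (∏ j, airyWeight x (w + (y j : ℂ) * Complex.I))
    * (interaction β (fun j => (y j : ℂ) * Complex.I) : ℂ)

theorem kontsevichIntegrand_verticalPoint (β : ℕ) (x c : ℝ) (y : Fin β → ℝ) :
    kontsevichIntegrand β x (verticalPoint β c y) = airyShift β x c y := by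
  rw [airyShift, ← interaction_add_const (c : ℂ)]
  rfl

theorem continuous_airyShift (β : ℕ) (x : ℝ) (w : ℂ) : Continuous (airyShift β x w) := by
  have hI := continuous_interaction β
  unfold airyShift airyWeight
  refine Continuous.mul (by fun_prop) (Complex.continuous_ofReal.comp (hI.comp (by fun_prop)))

theorem norm_sub_mul_I (s t : ℝ) : ‖(s : ℂ) * Complex.I - (t : ℂ) * Complex.I‖ = |s - t| := by
  rw [← sub_mul, norm_mul, Complex.norm_I, mul_one, ← Complex.ofReal_sub, Complex.norm_real,
    Real.norm_eq_abs]

/-- The absolute value of the translated integrand has an integrable majorant that is uniform for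
the translation parameter in a bounded part of the right half-plane, away from the axis. -/
theorem norm_airyShift_le {β : ℕ} (hβ : 2 ≤ β) (x : ℝ) {δ M S : ℝ} {w : ℂ} (hδ : 0 < δ)
    (h1 : δ ≤ w.re) (h2 : w.re ≤ M) (h3 : |w.im| ≤ S) (y : Fin β → ℝ) :
    ‖airyShift β x w y‖ ≤ (∏ i, Real.exp (M ^ 3 / 3 + M * S ^ 2 + |x| * M)
        * ((1 + |y i|) ^ 0 * Real.exp (-(δ / 2) * y i ^ 2)))
      * polyWeight y ^ interactionDegree β := by
  rw [airyShift, norm_mul, norm_prod, Complex.norm_real,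
    Real.norm_of_nonneg (interaction_nonneg _ _)]
  refine mul_le_mul (Finset.prod_le_prod (fun _ _ => norm_nonneg _) fun i _ => ?_)
    (interaction_le hβ fun j k => (norm_sub_mul_I _ _).le) (interaction_nonneg _ _)
    (Finset.prod_nonneg fun _ _ => by positivity)
  have hw : w + (y i : ℂ) * Complex.I = (w.re : ℂ) + ((w.im + y i : ℝ) : ℂ) * Complex.I := by
    conv_lhs => rw [← Complex.re_add_im w]
    push_cast; ring
  rw [hw, norm_airyWeight, pow_zero, one_mul, ← Real.exp_add]
  refine Real.exp_le_exp.2 ?_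
  have hS : w.im ^ 2 ≤ S ^ 2 := sq_le_sq' (by linarith [abs_le.1 h3]) (abs_le.1 h3).2
  have hM : 0 ≤ M := by linarith
  have e1 : w.re ^ 3 ≤ M ^ 3 := pow_le_pow_left₀ (by linarith) h2 3
  have e2 : -x * w.re ≤ |x| * M :=
    (mul_le_mul_of_nonneg_right (neg_le_abs x) (by linarith)).trans
      (mul_le_mul_of_nonneg_left h2 (abs_nonneg x))
  have e3 : w.re * (y i ^ 2 / 2 - S ^ 2) ≤ w.re * (w.im + y i) ^ 2 := by
    refine mul_le_mul_of_nonneg_left ?_ (by linarith)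
    nlinarith [sq_nonneg (2 * w.im + y i)]
  have e4 : δ * y i ^ 2 ≤ w.re * y i ^ 2 := mul_le_mul_of_nonneg_right h1 (sq_nonneg _)
  have e5 : w.re * S ^ 2 ≤ M * S ^ 2 := mul_le_mul_of_nonneg_right h2 (sq_nonneg _)
  nlinarith

theorem integrable_airyShift {β : ℕ} (hβ : 2 ≤ β) (x : ℝ) {w : ℂ} (hw : 0 < w.re) :
    Integrable (airyShift β x w) :=
  (integrable_prod_gaussian_mul_polyWeight _ 0 (interactionDegree β) (half_pos hw)).mono'
    (continuous_airyShift β x w).aestronglyMeasurable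
    (Eventually.of_forall (norm_airyShift_le hβ x hw le_rfl le_rfl le_rfl))

/-- The integral over vertical lines does not depend on the line: as a function of the common
translation of all variables it is holomorphic, and imaginary translations are absorbed by the
Lebesgue measure because the interaction is translation invariant. -/
theorem integral_airyShift_eq {β : ℕ} (hβ : 2 ≤ β) (x : ℝ) {w z : ℂ} (hw : 0 < w.re)
    (hz : 0 < z.re) : ∫ y, airyShift β x w y = ∫ y, airyShift β x z y := by
  refine eq_of_imaginary_translation_invariant (H := fun w => ∫ y, airyShift β x w y)
    (U := {w | 0 < w.re}) (convex_halfSpace_re_gt 0) (fun w hw => ?_) (fun w s => ?_) hw hz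
  · have hw : 0 < w.re := hw
    have hball : ∀ u ∈ Metric.ball w (w.re / 2), w.re / 2 ≤ u.re ∧ u.re ≤ 2 * w.re
        ∧ |u.im| ≤ |w.im| + w.re := by
      intro u hu
      have hu : ‖u - w‖ < w.re / 2 := by simpa [dist_eq_norm] using hu
      have hre := abs_le.1 ((Complex.abs_re_le_norm (u - w)).trans hu.le)
      have him := (Complex.abs_im_le_norm (u - w)).trans hu.le
      simp only [Complex.sub_re, Complex.sub_im] at hre him
      have := abs_sub_abs_le_abs_sub u.im w.im
      exact ⟨by linarith, by linarith, by linarith⟩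
    refine differentiableAt_integral_of_dominated_ball (half_pos hw)
      (integrable_prod_gaussian_mul_polyWeight _ 0 (interactionDegree β) (half_pos (half_pos hw)))
      (fun u => (continuous_airyShift β x u).aestronglyMeasurable) (fun y => ?_)
      (fun u hu y => norm_airyShift_le hβ x (half_pos hw) (hball u hu).1 (hball u hu).2.1
        (hball u hu).2.2 y)
    unfold airyShift airyWeight
    fun_prop
  · have h : ∀ y : Fin β → ℝ,
        airyShift β x (w + s * Complex.I) y = airyShift β x w (y + fun _ => s) := by
      intro y
      have hI : interaction β (fun j => (((y j + s : ℝ) : ℂ) * Complex.I))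
          = interaction β (fun j => (y j : ℂ) * Complex.I) :=
        interaction_congr fun j k => by
          rw [norm_sub_mul_I, norm_sub_mul_I, add_sub_add_right_eq_sub]
      simp only [airyShift, Pi.add_apply, hI]
      congr 1
      refine Finset.prod_congr rfl fun j _ => ?_
      congr 1
      push_cast
      ring
    simp only [h]
    exact integral_add_right_eq_self (airyShift β x w) (fun _ => s)

theorem kontsevichLine_eq (β : ℕ) (c x : ℝ) : kontsevichLine β c x
    = 1 / (2 * (Real.pi : ℂ) * Complex.I) ^ β * (Complex.I ^ β * ∫ y, airyShift β x c y) := by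
  rw [kontsevichLine]
  simp only [kontsevichIntegrand_verticalPoint, integral_const_mul]

/-- The regularized limit `c → 0⁺` is the limit of a constant function. -/
theorem kontsevichLine_eq_kontsevichK {β : ℕ} (hβ : 2 ≤ β) (x : ℝ) {c : ℝ} (hc : 0 < c) :
    kontsevichLine β c x = kontsevichK β x := by
  refine (Tendsto.limUnder_eq (tendsto_const_nhds.congr' ?_)).symm
  filter_upwards [self_mem_nhdsWithin] with c' hc'
  rw [kontsevichLine_eq, kontsevichLine_eq,
    integral_airyShift_eq hβ x (w := c) (z := c') (by simpa using hc) (by simpa using hc')]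

/-! ### The circle integral on smaller circles -/

/-- The one-variable factor `u e^{N f(u,t)}` of the circle integral, in the form
`e^{su} u u^{-N} (1 - u)^M` with `s = 4Nt`, `M = N + a - 2 + 2/β`; the factor `u` comes from
`du = i u dθ`. -/
noncomputable def circleWeight (N : ℕ) (M s : ℝ) (u : ℂ) : ℂ :=
  Complex.exp (s * u) * u * (u ^ N)⁻¹ * Complex.exp (M * Complex.log (1 - u))

/-- The integer power `u ^ N` removes the branch cut of `ln u`. -/
theorem mul_exp_laguerreF {a : ℝ} {N β : ℕ} (hN : 1 ≤ N) (t : ℝ) {u : ℂ} (hu : u ≠ 0) :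
    u * Complex.exp ((N : ℂ) * laguerreF a N β u t)
      = circleWeight N (N + a - 2 + 2 / β) (4 * N * t) u := by
  have hN0 : (N : ℂ) ≠ 0 := by exact_mod_cast (by omega : N ≠ 0)
  have h1 : (N : ℂ) * laguerreF a N β u t
      = ((4 * N * t : ℝ) : ℂ) * u + (-((N : ℂ) * Complex.log u))
        + ((N + a - 2 + 2 / β : ℝ) : ℂ) * Complex.log (1 - u) := by
    rw [laguerreF]
    push_cast
    field_simp
    ring
  rw [h1, Complex.exp_add, Complex.exp_add, Complex.exp_neg, Complex.exp_nat_mul,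
    Complex.exp_log hu, circleWeight]
  ring

theorem norm_circleWeight (N : ℕ) (M s : ℝ) (u : ℂ) : ‖circleWeight N M s u‖
    = Real.exp (s * u.re) * ‖u‖ * (‖u‖ ^ N)⁻¹ * Real.exp (M * Real.log ‖1 - u‖) := by
  simp [circleWeight, Complex.norm_exp, Complex.log_re]

theorem measurable_circleWeight (N : ℕ) (M s : ℝ) : Measurable (circleWeight N M s) := by
  unfold circleWeight
  fun_prop

theorem one_sub_mem_slitPlane {u : ℂ} (h1 : ‖u‖ ≤ 1) (hu : u ≠ 1) : 1 - u ∈ Complex.slitPlane := by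
  refine Complex.mem_slitPlane_iff.2 (or_iff_not_imp_left.2 fun h => ?_)
  intro him
  have hre : u.re = 1 := by
    have h2 := (Complex.re_le_norm u).trans h1
    simp only [Complex.sub_re, Complex.one_re, not_lt] at h
    linarith
  refine hu (Complex.ext (by simpa using hre) ?_)
  simpa using him

theorem differentiableAt_circleWeight {N : ℕ} {M s : ℝ} {u : ℂ} (h0 : u ≠ 0) (h1 : ‖u‖ ≤ 1)
    (hu : u ≠ 1) : DifferentiableAt ℂ (circleWeight N M s) u := by
  unfold circleWeight
  have h2 := one_sub_mem_slitPlane h1 hu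
  have h3 : u ^ N ≠ 0 := pow_ne_zero _ h0
  fun_prop (disch := assumption)

theorem norm_circleWeight_le {N : ℕ} {M s : ℝ} (hM : 0 ≤ M) {u : ℂ} (h0 : 1 / 2 ≤ ‖u‖)
    (h1 : ‖u‖ ≤ 1) :
    ‖circleWeight N M s u‖ ≤ Real.exp |s| * 1 * 2 ^ N * Real.exp (M * Real.log 2) := by
  rw [norm_circleWeight]
  have e1 : s * u.re ≤ |s| := by
    refine (le_abs_self _).trans ?_
    rw [abs_mul]
    exact mul_le_of_le_one_right (abs_nonneg _) ((Complex.abs_re_le_norm u).trans h1)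
  have e2 : (‖u‖ ^ N)⁻¹ ≤ 2 ^ N := by
    rw [← inv_pow]
    refine pow_le_pow_left₀ (by positivity) ?_ N
    rw [inv_le_comm₀ (by linarith) (by norm_num)]
    linarith
  have e3 : Real.log ‖1 - u‖ ≤ Real.log 2 := by
    rcases (norm_nonneg (1 - u)).eq_or_lt with h | h
    · -- at `u = 1` the convention `Real.log 0 = 0` keeps the bound valid
      rw [← h, Real.log_zero]; positivity
    · refine Real.log_le_log h ((norm_sub_le _ _).trans ?_)
      rw [norm_one]; linarith
  gcongr

/-- The integrand on the torus when every variable runs over the circle through `ζ`, the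
interaction being evaluated on the unit circle. -/
noncomputable def torusIntegrand (β : ℕ) (h : ℂ → ℂ) (ζ : ℂ)
    (x : Fin β → AddCircle (2 * Real.pi)) : ℂ :=
  (∏ j, h (ζ * angleToCircle (x j))) * (interaction β (fun j => angleToCircle (x j)) : ℂ)

theorem measurable_torusIntegrand {β : ℕ} {h : ℂ → ℂ} (hh : Measurable h) (ζ : ℂ) :
    Measurable (torusIntegrand β h ζ) := by
  have hI := (continuous_interaction β).measurable
  have hc := continuous_angleToCircle.measurable
  unfold torusIntegrand
  refine Measurable.mul ?_ (Complex.measurable_ofReal.comp (hI.comp (by fun_prop)))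
  exact Finset.measurable_prod _ fun j _ => by fun_prop

/-- The bound `B` comes from the interaction, a continuous function on the compact torus, and serves
all factors `h` and all radii. -/
theorem exists_norm_torusIntegrand_le (β : ℕ) : ∃ B : ℝ, ∀ (h : ℂ → ℂ) (C : ℝ) (ζ : ℂ),
    (∀ u, ‖u‖ = ‖ζ‖ → ‖h u‖ ≤ C) → ∀ x, ‖torusIntegrand β h ζ x‖ ≤ C ^ β * B := by
  have hcont : Continuous fun x : Fin β → AddCircle (2 * Real.pi) =>
      interaction β (fun j => angleToCircle (x j)) := by
    have hc := continuous_angleToCircle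
    exact (continuous_interaction β).comp (by fun_prop)
  obtain ⟨B, hB⟩ := isCompact_univ.exists_bound_of_continuousOn hcont.continuousOn
  refine ⟨B, fun h C ζ hC x => ?_⟩
  rw [torusIntegrand, norm_mul, norm_prod, Complex.norm_real]
  refine mul_le_mul ?_ (hB x trivial) (norm_nonneg _)
    (pow_nonneg ((norm_nonneg _).trans (hC ζ rfl)) _)
  calc ∏ j, ‖h (ζ * angleToCircle (x j))‖ ≤ ∏ _j : Fin β, C :=
        Finset.prod_le_prod (fun _ _ => norm_nonneg _)
          fun j _ => hC _ (by rw [norm_mul, norm_angleToCircle, mul_one])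
    _ = C ^ β := by simp

/-- For a factor holomorphic in the punctured unit disc the torus integral does not depend on the
radius: it is holomorphic in the logarithm of the common dilation, and rotations are absorbed by
the Haar measure because the interaction is rotation invariant. -/
theorem integral_torusIntegrand_exp_eq {β : ℕ} {h : ℂ → ℂ} (hh : Measurable h)
    (hd : ∀ u, u ≠ 0 → ‖u‖ < 1 → DifferentiableAt ℂ h u) {w z : ℂ} (hw : w.re < 0)
    (hz : z.re < 0) :
    ∫ x, torusIntegrand β h (Complex.exp w) x = ∫ x, torusIntegrand β h (Complex.exp z) x := by
  refine eq_of_imaginary_translation_invariant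
    (H := fun w => ∫ x, torusIntegrand β h (Complex.exp w) x)
    (U := {w | w.re < 0}) (convex_halfSpace_re_lt 0) (fun w hw => ?_) (fun w s => ?_) hw hz
  · have hw : w.re < 0 := hw
    set r := -w.re / 2 with hr
    have hr0 : 0 < r := by linarith
    have hball : ∀ v ∈ Metric.ball w r, w.re - r ≤ v.re ∧ v.re ≤ w.re + r := by
      intro v hv
      have hv : ‖v - w‖ < r := by simpa [dist_eq_norm] using hv
      have hre := abs_le.1 ((Complex.abs_re_le_norm (v - w)).trans hv.le)
      simp only [Complex.sub_re] at hre
      exact ⟨by linarith, by linarith⟩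
    have hK : IsCompact ({u : ℂ | Real.exp (w.re - r) ≤ ‖u‖}
        ∩ Metric.closedBall 0 (Real.exp (w.re + r))) :=
      (isCompact_closedBall _ _).inter_left (isClosed_le continuous_const continuous_norm)
    obtain ⟨C, hC⟩ := hK.exists_bound_of_continuousOn (f := h) fun u hu => by
      have h1 : Real.exp (w.re - r) ≤ ‖u‖ := hu.1
      have h2 : ‖u‖ ≤ Real.exp (w.re + r) := by simpa using hu.2
      refine (hd u ?_ ?_).continuousAt.continuousWithinAt
      · exact norm_pos_iff.1 ((Real.exp_pos _).trans_le h1)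
      · exact h2.trans_lt (Real.exp_lt_one_iff.2 (by linarith))
    obtain ⟨B, hB⟩ := exists_norm_torusIntegrand_le β
    refine differentiableAt_integral_of_dominated_ball hr0
      (integrable_const (C ^ β * B))
      (fun v => (measurable_torusIntegrand hh _).aestronglyMeasurable)
      (fun x v hv => ?_) (fun v hv x => ?_)
    · unfold torusIntegrand
      refine DifferentiableAt.differentiableWithinAt (DifferentiableAt.mul_const ?_ _)
      refine DifferentiableAt.fun_finsetProd fun j _ => ?_
      refine DifferentiableAt.comp v (hd _ ?_ ?_) (by fun_prop)
      · refine mul_ne_zero (Complex.exp_ne_zero _) (norm_ne_zero_iff.1 ?_)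
        rw [norm_angleToCircle]; exact one_ne_zero
      · rw [norm_mul, norm_angleToCircle, mul_one, Complex.norm_exp]
        exact Real.exp_lt_one_iff.2 (by linarith [(hball v hv).2])
    · refine hB h C _ (fun u hu => hC u ⟨?_, ?_⟩) x
      · rw [Set.mem_ofPred_eq, hu, Complex.norm_exp]
        exact Real.exp_le_exp.2 (hball v hv).1
      · rw [mem_closedBall_zero_iff, hu, Complex.norm_exp]
        exact Real.exp_le_exp.2 (hball v hv).2
  · have hs : ∀ x, torusIntegrand β h (Complex.exp (w + s * Complex.I)) x
        = torusIntegrand β h (Complex.exp w) (x + fun _ => (s : AddCircle (2 * Real.pi))) := by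
      intro x
      simp only [torusIntegrand, Pi.add_apply, angleToCircle_add, angleToCircle_coe]
      have hI : interaction β (fun j => angleToCircle (x j) * Complex.exp (s * Complex.I))
          = interaction β (fun j => angleToCircle (x j)) := by
        simp only [mul_comm _ (Complex.exp _)]
        exact interaction_smul_of_norm_eq_one (Complex.norm_exp_ofReal_mul_I s) _
      rw [hI, Complex.exp_add]
      congr 1
      refine Finset.prod_congr rfl fun j _ => ?_
      congr 1
      ring
    simp only [hs]
    exact integral_add_right_eq_self (torusIntegrand β h (Complex.exp w)) _

theorem angleToCircle_eq_one_iff (x : AddCircle (2 * Real.pi)) : angleToCircle x = 1 ↔ x = 0 := by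
  rw [angleToCircle, Circle.coe_eq_one, ← AddCircle.toCircle_zero (T := 2 * Real.pi)]
  exact (AddCircle.injective_toCircle Real.two_pi_pos.ne').eq_iff

theorem ae_angleToCircle_ne_one (β : ℕ) :
    ∀ᵐ x : Fin β → AddCircle (2 * Real.pi), ∀ j, angleToCircle (x j) ≠ 1 := by
  refine ae_all_iff.2 fun j => ?_
  simp only [ne_eq, angleToCircle_eq_one_iff]
  have h : ∀ᵐ x : AddCircle (2 * Real.pi), x ≠ 0 := by
    refine compl_mem_ae_iff.2 ?_
    change volume {(0 : AddCircle (2 * Real.pi))} = 0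
    rw [← (AddCircle.measurePreserving_mk (2 * Real.pi) 0).measure_preimage
      (measurableSet_singleton _).nullMeasurableSet]
    refine Set.Countable.measure_zero ?_ _
    have hpre : (fun x : ℝ => (x : AddCircle (2 * Real.pi))) ⁻¹' {0}
        = AddSubgroup.zmultiples (2 * Real.pi) := by
      ext x
      simp [AddSubgroup.mem_zmultiples_iff]
    change ((fun x : ℝ => (x : AddCircle (2 * Real.pi))) ⁻¹' {0}).Countable
    rw [hpre]
    exact Set.countable_range _
  exact (Measure.tendsto_eval_ae_ae (μ := fun _ : Fin β =>
    (volume : Measure (AddCircle (2 * Real.pi)))) (i := j)).eventually h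

/-- The torus integral of the bounded factor `circleWeight` keeps its value as the radius grows
to `1`. -/
theorem integral_torusIntegrand_circleWeight {β N : ℕ} {M s : ℝ} (hM : 0 ≤ M) {w : ℂ}
    (hw : w.re < 0) :
    ∫ x, torusIntegrand β (circleWeight N M s) 1 x
      = ∫ x, torusIntegrand β (circleWeight N M s) (Complex.exp w) x := by
  have hmeas := measurable_circleWeight N M s
  set v : ℕ → ℂ := fun n => ((-(1 / ((n : ℝ) + 1) * Real.log 2) : ℝ) : ℂ) with hv
  have hlog : 0 < Real.log 2 := Real.log_pos (by norm_num)
  have hv0 : ∀ n, (v n).re < 0 := fun n => by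
    simp only [hv, Complex.ofReal_re]
    have : 0 < 1 / ((n : ℝ) + 1) * Real.log 2 := by positivity
    linarith
  have hv1 : ∀ n, -Real.log 2 ≤ (v n).re := fun n => by
    simp only [hv, Complex.ofReal_re]
    have h1 : 1 / ((n : ℝ) + 1) ≤ 1 := by
      rw [div_le_one (by positivity)]
      linarith [(Nat.cast_nonneg n : (0 : ℝ) ≤ n)]
    nlinarith
  have hvt : Tendsto (fun n => Complex.exp (v n)) atTop (𝓝 1) := by
    have h1 : Tendsto v atTop (𝓝 ((-(0 * Real.log 2) : ℝ) : ℂ)) :=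
      (Complex.continuous_ofReal.tendsto _).comp
        (tendsto_one_div_add_atTop_nhds_zero_nat.mul_const _).neg
    simpa using h1.cexp
  obtain ⟨B, hB⟩ := exists_norm_torusIntegrand_le β
  have hlim := tendsto_integral_of_dominated_convergence
    (F := fun n => torusIntegrand β (circleWeight N M s) (Complex.exp (v n)))
    (f := torusIntegrand β (circleWeight N M s) 1) (μ := volume)
    (fun _ => (Real.exp |s| * 1 * 2 ^ N * Real.exp (M * Real.log 2)) ^ β * B)
    (fun n => (measurable_torusIntegrand hmeas _).aestronglyMeasurable) (integrable_const _)
    (fun n => Eventually.of_forall (hB _ _ _ fun u hu => ?_)) ?_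
  · refine tendsto_nhds_unique hlim (tendsto_const_nhds.congr fun n => ?_)
    refine integral_torusIntegrand_exp_eq hmeas (fun u h0 h1 => ?_) hw (hv0 n)
    refine differentiableAt_circleWeight h0 h1.le ?_
    rintro rfl
    simp at h1
  · rw [Complex.norm_exp] at hu
    refine norm_circleWeight_le hM ?_ ?_
    · rw [hu, one_div, ← Real.exp_log (by norm_num : (0 : ℝ) < 2), ← Real.exp_neg]
      exact Real.exp_le_exp.2 (hv1 n)
    · rw [hu]
      exact Real.exp_le_one_iff.2 (hv0 n).le
  · filter_upwards [ae_angleToCircle_ne_one β] with x hx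
    unfold torusIntegrand
    refine Tendsto.mul_const _ (tendsto_finsetProd _ fun j _ => ?_)
    have h1 : ContinuousAt (circleWeight N M s) (1 * angleToCircle (x j)) := by
      rw [one_mul]
      refine (differentiableAt_circleWeight (norm_ne_zero_iff.1 ?_) ?_ (hx j)).continuousAt
      · rw [norm_angleToCircle]; exact one_ne_zero
      · rw [norm_angleToCircle]
    exact h1.tendsto.comp (hvt.mul_const _)

theorem rIntegral_laguerreF {a : ℝ} {N β : ℕ} (hN : 1 ≤ N) (t : ℝ) :
    rIntegral (laguerreF a N β) N β t = Complex.I ^ β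
      * ∫ x, torusIntegrand β (circleWeight N (N + a - 2 + 2 / β) (4 * N * t)) 1 x := by
  have hG : Measurable fun z : Fin β → ℂ =>
      (∏ j, circleWeight N (N + a - 2 + 2 / β) (4 * N * t) (1 * z j)) * (interaction β z : ℂ) := by
    have h1 := measurable_circleWeight N (N + a - 2 + 2 / β) (4 * N * t)
    have hI := (continuous_interaction β).measurable
    exact (Finset.measurable_prod _ fun j _ => by fun_prop).mul (Complex.measurable_ofReal.comp hI)
  have h := setIntegral_box_eq_integral_torus hG 0
  unfold torusIntegrand
  rw [← h, ← integral_const_mul, rIntegral, torusIntegral]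
  simp only [zero_add]
  refine setIntegral_congr_fun measurableSet_Icc fun θ _ => ?_
  have hmap : torusMap (fun _ : Fin β => (0 : ℂ)) (fun _ => (1 : ℝ)) θ
      = fun j => Complex.exp (θ j * Complex.I) := by
    funext j; simp [torusMap]
  simp only [hmap, rIntegrand, smul_eq_mul, ← mul_exp_laguerreF hN t (Complex.exp_ne_zero _),
    Finset.prod_mul_distrib, Complex.ofReal_one, one_mul, Finset.prod_const, Finset.card_univ,
    Fintype.card_fin]
  ring

/-! ### Absolute convergence on the unit circle -/

theorem norm_one_sub_exp_mul_I (θ : ℝ) :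
    ‖1 - Complex.exp (θ * Complex.I)‖ = |2 * Real.sin (θ / 2)| := by
  rw [norm_sub_rev, mul_comm, Complex.norm_exp_I_mul_ofReal_sub_one, Real.norm_eq_abs]

/-- On `(0, 2π)` the factor `|1 - e^{iθ}| ^ M` has at worst the end-point singularities of
`θ ^ M` and `(2π - θ) ^ M`. -/
theorem rpow_norm_one_sub_exp_le (M : ℝ) {θ : ℝ} (h0 : 0 < θ) (h1 : θ < 2 * Real.pi) :
    ‖1 - Complex.exp (θ * Complex.I)‖ ^ M
      ≤ 2 ^ |M| + (2 / Real.pi) ^ M * (θ ^ M + (2 * Real.pi - θ) ^ M) := by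
  have hpi := Real.pi_pos
  rw [norm_one_sub_exp_mul_I]
  have hsin : 0 < Real.sin (θ / 2) := Real.sin_pos_of_pos_of_lt_pi (by linarith) (by linarith)
  rw [abs_of_pos (by linarith)]
  have p1 : 0 ≤ (2 / Real.pi) ^ M * θ ^ M := by positivity
  have h2 : 0 < 2 * Real.pi - θ := by linarith
  have p2 : 0 ≤ (2 / Real.pi) ^ M * (2 * Real.pi - θ) ^ M := by positivity
  have p3 : (0 : ℝ) ≤ 2 ^ |M| := by positivity
  rw [mul_add]
  rcases le_total 0 M with hM | hM
  · have : (2 * Real.sin (θ / 2)) ^ M ≤ 2 ^ |M| := by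
      rw [abs_of_nonneg hM]
      exact Real.rpow_le_rpow (by linarith) (by linarith [Real.sin_le_one (θ / 2)]) hM
    linarith
  · rcases le_total θ Real.pi with h | h
    · have hs := Real.mul_le_sin (x := θ / 2) (by linarith) (by linarith)
      have : (2 * Real.sin (θ / 2)) ^ M ≤ (2 / Real.pi * θ) ^ M :=
        Real.rpow_le_rpow_of_nonpos (by positivity) (by linarith) hM
      rw [Real.mul_rpow (by positivity) h0.le] at this
      linarith
    · have hs := Real.mul_le_sin (x := Real.pi - θ / 2) (by linarith) (by linarith)
      rw [Real.sin_pi_sub] at hs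
      have : (2 * Real.sin (θ / 2)) ^ M ≤ (2 / Real.pi * (2 * Real.pi - θ)) ^ M :=
        Real.rpow_le_rpow_of_nonpos (by positivity) (by linarith) hM
      rw [Real.mul_rpow (by positivity) h2.le] at this
      linarith

theorem integrableOn_circleWeight (N : ℕ) {M : ℝ} (s : ℝ) (hM : -1 < M) :
    IntegrableOn (fun θ : ℝ => circleWeight N M s (Complex.exp (θ * Complex.I)))
      (Set.Icc 0 (2 * Real.pi)) := by
  rw [integrableOn_Icc_iff_integrableOn_Ioo]
  have hi : IntervalIntegrable (fun θ : ℝ => θ ^ M) volume 0 (2 * Real.pi) :=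
    intervalIntegral.intervalIntegrable_rpow' hM
  have hi2 : IntervalIntegrable (fun θ : ℝ => (2 * Real.pi - θ) ^ M) volume 0 (2 * Real.pi) := by
    have := (hi.comp_sub_left (2 * Real.pi)).symm
    simpa using this
  have hi3 := (intervalIntegrable_const (c := (2 : ℝ) ^ |M|)).add
    ((hi.add hi2).const_mul ((2 / Real.pi) ^ M))
  rw [intervalIntegrable_iff_integrableOn_Ioo_of_le Real.two_pi_pos.le] at hi3
  refine (hi3.const_mul (Real.exp |s|)).mono' ?_ ?_
  · have := measurable_circleWeight N M s
    exact Measurable.aestronglyMeasurable (by fun_prop)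
  · refine (ae_restrict_iff' measurableSet_Ioo).2 (Eventually.of_forall fun θ hθ => ?_)
    have hne : 0 < ‖1 - Complex.exp (θ * Complex.I)‖ := by
      rw [norm_one_sub_exp_mul_I]
      have := Real.sin_pos_of_pos_of_lt_pi (x := θ / 2) (by linarith [hθ.1]) (by linarith [hθ.2])
      positivity
    rw [norm_circleWeight, Complex.norm_exp_ofReal_mul_I, one_pow, inv_one, mul_one, mul_one,
      mul_comm M, ← Real.rpow_def_of_pos hne]
    have hre : (Complex.exp (θ * Complex.I)).re = Real.cos θ := Complex.exp_ofReal_mul_I_re θ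
    have hs : s * (Complex.exp (θ * Complex.I)).re ≤ |s| := by
      rw [hre]
      refine (le_abs_self _).trans ?_
      rw [abs_mul]
      exact mul_le_of_le_one_right (abs_nonneg _) (Real.abs_cos_le_one θ)
    exact mul_le_mul (Real.exp_le_exp.2 hs) (rpow_norm_one_sub_exp_le M hθ.1 hθ.2)
      (by positivity) (by positivity)

/-- Absolute convergence already for `N = 1`, where the exponent of `1 - u` may be negative but
exceeds `-1`. -/
theorem torusIntegrable_rIntegrand {β : ℕ} (hβ : 0 < β) {a : ℝ} (ha : 0 ≤ a) {N : ℕ} (hN : 1 ≤ N)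
    (t : ℝ) :
    TorusIntegrable (rIntegrand (laguerreF a N β) N β t) (fun _ => 0) (fun _ => 1) := by
  have hM : -1 < (N : ℝ) + a - 2 + 2 / β := by
    have h1 : (1 : ℝ) ≤ N := by exact_mod_cast hN
    have h2 : (0 : ℝ) < 2 / β := by positivity
    linarith
  have hint := Integrable.fintype_prod (fun _ : Fin β =>
    (integrableOn_circleWeight N (4 * N * t) hM).norm)
  rw [← Measure.restrict_pi_pi, ← volume_pi, Set.pi_univ_Icc] at hint
  have hmap : ∀ θ : Fin β → ℝ, torusMap (fun _ : Fin β => (0 : ℂ)) (fun _ => (1 : ℝ)) θ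
      = fun j => Complex.exp (θ j * Complex.I) := by
    intro θ; funext j; simp [torusMap]
  have hcont : Continuous fun θ : Fin β → ℝ =>
      interaction β (fun j => Complex.exp (θ j * Complex.I)) :=
    (continuous_interaction β).comp (by fun_prop)
  obtain ⟨B, hB⟩ := (isCompact_Icc (a := (0 : Fin β → ℝ))
    (b := fun _ => 2 * Real.pi)).exists_bound_of_continuousOn hcont.continuousOn
  refine (hint.mul_const B).mono' ?_ ?_
  · have hI := (continuous_interaction β).measurable
    simp only [hmap, rIntegrand, laguerreF]
    refine Measurable.aestronglyMeasurable (Measurable.mul ?_ ?_)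
    · exact Finset.measurable_prod _ fun j _ => by fun_prop
    · exact Complex.measurable_ofReal.comp (hI.comp (by fun_prop))
  · refine (ae_restrict_iff' measurableSet_Icc).2 (Eventually.of_forall fun θ hθ => ?_)
    rw [hmap, rIntegrand, norm_mul, norm_prod, Complex.norm_real]
    refine mul_le_mul (Finset.prod_le_prod (fun _ _ => norm_nonneg _) fun j _ => ?_) (hB θ hθ)
      (norm_nonneg _) (Finset.prod_nonneg fun _ _ => norm_nonneg _)
    rw [← mul_exp_laguerreF hN t (Complex.exp_ne_zero _), norm_mul, Complex.norm_exp_ofReal_mul_I,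
      one_mul]

/-! ### Rescaling the angles -/

theorem sum_card_Ioi_fin (β : ℕ) :
    (∑ j : Fin β, ((Finset.Ioi j).card : ℝ)) * 2 = β * (β - 1) := by
  have h : ∑ j : Fin β, (Finset.Ioi j).card = ∑ i ∈ Finset.range β, i := by
    simp only [Fin.card_Ioi]
    rw [Fin.sum_univ_eq_sum_range (fun i => β - 1 - i) β, Finset.sum_range_reflect (fun i => i) β]
  rw [← Nat.cast_sum, h]
  rcases β with _ | n
  · simp
  · have := Finset.sum_range_id_mul_two (n + 1)
    have h2 : ((∑ i ∈ Finset.range (n + 1), i : ℕ) : ℝ) * 2 = ((n + 1) * n : ℕ) := by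
      exact_mod_cast this
    rw [h2]; push_cast; ring

/-- The interaction is homogeneous of degree `(4/β) · β(β-1)/2 = 2(β-1)`. -/
theorem interaction_ofReal_mul {β : ℕ} (hβ : 0 < β) {m : ℝ} (hm : 0 < m) (z : Fin β → ℂ) :
    interaction β (fun j => (m : ℂ) * z j) = m ^ (2 * ((β : ℝ) - 1)) * interaction β z := by
  have hfac : ∀ j k, ‖(m : ℂ) * z j - m * z k‖ ^ (4 / (β : ℝ))
      = m ^ (4 / (β : ℝ)) * ‖z j - z k‖ ^ (4 / (β : ℝ)) := by
    intro j k
    rw [← mul_sub, norm_mul, Complex.norm_real, Real.norm_of_nonneg hm.le,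
      Real.mul_rpow hm.le (norm_nonneg _)]
  simp only [interaction, hfac, Finset.prod_mul_distrib]
  congr 1
  simp only [Finset.prod_const, ← Real.rpow_natCast, ← Real.rpow_mul hm.le]
  rw [← Real.rpow_sum_of_pos hm, ← Finset.mul_sum]
  congr 1
  have h := sum_card_Ioi_fin β
  have hb : (β : ℝ) ≠ 0 := by positivity
  field_simp
  linear_combination 2 * h

/-- The torus integral in the variables `y = -m θ`, extended by zero to the whole space. -/
theorem integral_torusIntegrand_eq_integral_indicator {β : ℕ} (hβ : 0 < β) {h : ℂ → ℂ}
    (hh : Measurable h) (ζ : ℂ) {m : ℝ} (hm : 0 < m) :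
    ∫ x, torusIntegrand β h ζ x = ((m ^ (2 - 3 * (β : ℝ)) : ℝ) : ℂ) * ∫ y : Fin β → ℝ,
      (∏ j, Set.indicator {t : ℝ | |t| ≤ Real.pi * m}
        (fun t : ℝ => h (ζ * Complex.exp ((-t / m : ℝ) * Complex.I))) (y j))
      * (interaction β (fun j => (m : ℂ) * Complex.exp ((-y j / m : ℝ) * Complex.I)) : ℂ) := by
  set F : (Fin β → ℝ) → ℂ := fun θ => (∏ j, Set.indicator {t : ℝ | |t| ≤ Real.pi}
    (fun t : ℝ => h (ζ * Complex.exp (t * Complex.I))) (θ j))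
      * (interaction β (fun j => Complex.exp (θ j * Complex.I)) : ℂ) with hF
  have h1 : ∫ x, torusIntegrand β h ζ x = ∫ θ, F θ := by
    have hG : Measurable fun z : Fin β → ℂ => (∏ j, h (ζ * z j)) * (interaction β z : ℂ) := by
      have hI := (continuous_interaction β).measurable
      exact (Finset.measurable_prod _ fun j _ => by fun_prop).mul
        (Complex.measurable_ofReal.comp hI)
    have h2 := setIntegral_box_eq_integral_torus hG (-Real.pi)
    unfold torusIntegrand
    rw [← h2, ← integral_indicator measurableSet_Icc]
    refine integral_congr_ae (Eventually.of_forall fun θ => ?_)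
    have hmem : θ ∈ Set.Icc (fun _ : Fin β => -Real.pi) (fun _ => -Real.pi + 2 * Real.pi)
        ↔ ∀ j, |θ j| ≤ Real.pi := by
      have h3 : -Real.pi + 2 * Real.pi = Real.pi := by ring
      simp only [Set.mem_Icc, Pi.le_def, h3, abs_le, forall_and]
    by_cases hθ : ∀ j, |θ j| ≤ Real.pi
    · simp only [hF]
      rw [Set.indicator_of_mem (hmem.2 hθ)]
      congr 1
      exact Finset.prod_congr rfl fun j _ => by rw [Set.indicator_of_mem]; exact hθ j
    · simp only [hF]
      rw [Set.indicator_of_notMem (mt hmem.1 hθ)]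
      push Not at hθ
      obtain ⟨j, hj⟩ := hθ
      rw [Finset.prod_eq_zero (Finset.mem_univ j), zero_mul]
      exact Set.indicator_of_notMem
        (show θ j ∉ {t : ℝ | |t| ≤ Real.pi} from fun h => hj.not_ge h) _
  have h2 := Measure.integral_comp_smul (volume : Measure (Fin β → ℝ)) F (-1 / m)
  have h3 : ∀ y : Fin β → ℝ, (∏ j, Set.indicator {t : ℝ | |t| ≤ Real.pi * m}
        (fun t : ℝ => h (ζ * Complex.exp ((-t / m : ℝ) * Complex.I))) (y j))
      * (interaction β (fun j => (m : ℂ) * Complex.exp ((-y j / m : ℝ) * Complex.I)) : ℂ)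
      = ((m ^ (2 * ((β : ℝ) - 1)) : ℝ) : ℂ) * F ((-1 / m) • y) := by
    intro y
    have hsm : ∀ j, ((-1 / m) • y) j = -y j / m := fun j => by
      rw [Pi.smul_apply, smul_eq_mul]; ring
    simp only [hF, hsm, interaction_ofReal_mul hβ hm]
    rw [Complex.ofReal_mul, mul_left_comm]
    congr 2
    refine Finset.prod_congr rfl fun j _ => ?_
    have hiff : |-y j / m| ≤ Real.pi ↔ |y j| ≤ Real.pi * m := by
      rw [abs_div, abs_neg, abs_of_pos hm, div_le_iff₀ hm]
    by_cases hj : |y j| ≤ Real.pi * m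
    · rw [Set.indicator_of_mem (show y j ∈ {t : ℝ | |t| ≤ Real.pi * m} from hj),
        Set.indicator_of_mem (show -y j / m ∈ {t : ℝ | |t| ≤ Real.pi} from hiff.2 hj)]
    · rw [Set.indicator_of_notMem (show y j ∉ {t : ℝ | |t| ≤ Real.pi * m} from hj),
        Set.indicator_of_notMem (show -y j / m ∉ {t : ℝ | |t| ≤ Real.pi} from mt hiff.1 hj)]
  simp only [h3]
  rw [integral_const_mul, h2, h1, Module.finrank_fintype_fun_eq_card, Fintype.card_fin,
    Complex.real_smul, ← mul_assoc, ← mul_assoc, ← Complex.ofReal_mul, ← Complex.ofReal_mul]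
  have habs : |((-1 / m) ^ β)⁻¹| = m ^ (β : ℝ) := by
    rw [abs_inv, abs_pow, abs_div, abs_neg, abs_one, abs_of_pos hm, Real.rpow_natCast]
    simp
  rw [habs, ← Real.rpow_add hm, ← Real.rpow_add hm]
  have hexp : 2 - 3 * (β : ℝ) + 2 * ((β : ℝ) - 1) + β = 0 := by ring
  rw [hexp, Real.rpow_zero, Complex.ofReal_one, one_mul]

/-! ### The phase at its double saddle point -/

/-- Integrating a bound `‖f'(w)‖ ≤ C ‖w‖ ^ n` on the closed right half-plane. -/
theorem norm_sub_apply_zero_le {f f' : ℂ → ℂ} {C : ℝ} (hC : 0 ≤ C) {n : ℕ}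
    (hf : ∀ w : ℂ, 0 ≤ w.re → HasDerivAt f (f' w) w)
    (hb : ∀ w : ℂ, 0 ≤ w.re → ‖f' w‖ ≤ C * ‖w‖ ^ n) {z : ℂ} (hz : 0 ≤ z.re) :
    ‖f z - f 0‖ ≤ C * ‖z‖ ^ (n + 1) := by
  have hconv : Convex ℝ ({w : ℂ | 0 ≤ w.re} ∩ Metric.closedBall 0 ‖z‖) :=
    (convex_halfSpace_re_ge 0).inter (convex_closedBall 0 ‖z‖)
  have := hconv.norm_image_sub_le_of_norm_hasDerivWithin_le (C := C * ‖z‖ ^ n)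
    (fun w hw => (hf w hw.1).hasDerivWithinAt) (fun w hw => (hb w hw.1).trans ?_)
    (x := 0) (y := z) (by simp) (by simpa using hz)
  · rw [sub_zero] at this
    rwa [pow_succ, ← mul_assoc]
  · have hw2 : ‖w‖ ≤ ‖z‖ := by simpa using hw.2
    gcongr

theorem norm_exp_neg_le_one {z : ℂ} (hz : 0 ≤ z.re) : ‖Complex.exp (-z)‖ ≤ 1 := by
  rw [Complex.norm_exp, Complex.neg_re]
  exact Real.exp_le_one_iff.2 (by linarith)

theorem one_le_re_two_sub_exp_neg {z : ℂ} (hz : 0 ≤ z.re) : 1 ≤ (2 - Complex.exp (-z)).re := by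
  have := (Complex.re_le_norm _).trans (norm_exp_neg_le_one hz)
  simp only [Complex.sub_re, Complex.re_ofNat]
  linarith

theorem one_le_norm_two_sub_exp_neg {z : ℂ} (hz : 0 ≤ z.re) : 1 ≤ ‖2 - Complex.exp (-z)‖ :=
  (one_le_re_two_sub_exp_neg hz).trans (Complex.re_le_norm _)

theorem two_sub_exp_neg_ne_zero {z : ℂ} (hz : 0 ≤ z.re) : 2 - Complex.exp (-z) ≠ 0 :=
  norm_pos_iff.1 (zero_lt_one.trans_le (one_le_norm_two_sub_exp_neg hz))

theorem hasDerivAt_exp_neg (z : ℂ) :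
    HasDerivAt (fun z => Complex.exp (-z)) (-Complex.exp (-z)) z := by
  simpa using (hasDerivAt_neg z).cexp

theorem hasDerivAt_log_two_sub_exp_neg {z : ℂ} (hz : 0 ≤ z.re) :
    HasDerivAt (fun z => Complex.log (2 - Complex.exp (-z)))
      (Complex.exp (-z) / (2 - Complex.exp (-z))) z := by
  have h := ((hasDerivAt_exp_neg z).const_sub 2).clog (Complex.mem_slitPlane_iff.2
    (Or.inl (zero_lt_one.trans_le (one_le_re_two_sub_exp_neg hz))))
  simpa using h

theorem norm_one_sub_exp_neg_le {z : ℂ} (hz : 0 ≤ z.re) : ‖1 - Complex.exp (-z)‖ ≤ ‖z‖ := by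
  have := norm_sub_apply_zero_le (f := fun z => Complex.exp (-z)) (C := 1) (n := 0) zero_le_one
    (fun w _ => hasDerivAt_exp_neg w)
    (fun w hw => by simpa using norm_exp_neg_le_one hw) hz
  rw [norm_sub_rev]
  simpa using this

theorem norm_exp_neg_sub_one_add_le {z : ℂ} (hz : 0 ≤ z.re) :
    ‖Complex.exp (-z) - 1 + z‖ ≤ ‖z‖ ^ 2 := by
  have := norm_sub_apply_zero_le (f := fun z => Complex.exp (-z) - 1 + z) (C := 1) (n := 1)
    zero_le_one (fun w _ => ((hasDerivAt_exp_neg w).sub_const 1).add (hasDerivAt_id w))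
    (fun w hw => by
      rw [one_mul, pow_one, neg_add_eq_sub]
      exact norm_one_sub_exp_neg_le hw) hz
  simpa using this

theorem norm_log_two_sub_exp_neg_le {z : ℂ} (hz : 0 ≤ z.re) :
    ‖Complex.log (2 - Complex.exp (-z))‖ ≤ ‖z‖ := by
  have := norm_sub_apply_zero_le (f := fun z => Complex.log (2 - Complex.exp (-z))) (C := 1)
    (n := 0) zero_le_one (fun w hw => hasDerivAt_log_two_sub_exp_neg hw)
    (fun w hw => by
      rw [norm_div, pow_zero, mul_one]
      exact div_le_one_of_le₀ ((norm_exp_neg_le_one hw).trans (one_le_norm_two_sub_exp_neg hw))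
        (norm_nonneg _)) hz
  have h0 : Complex.log (2 - Complex.exp (-0)) = 0 := by
    rw [neg_zero, Complex.exp_zero]; norm_num
  simpa only [h0, sub_zero, one_mul, zero_add, pow_one] using this

/-- The phase `2u - (ln u)/2 + (ln (1 - u))/2` in the coordinate `u = e^{-z}/2`, with the constant
terms `ln 2` removed; the double saddle point `u = 1/2` becomes `z = 0`. -/
noncomputable def saddlePhase (z : ℂ) : ℂ :=
  Complex.exp (-z) + z / 2 + Complex.log (2 - Complex.exp (-z)) / 2

theorem hasDerivAt_saddlePhase {z : ℂ} (hz : 0 ≤ z.re) : HasDerivAt saddlePhase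
    ((1 - Complex.exp (-z)) ^ 2 / (2 - Complex.exp (-z))) z := by
  have h := ((hasDerivAt_exp_neg z).add ((hasDerivAt_id z).div_const 2)).add
    ((hasDerivAt_log_two_sub_exp_neg hz).div_const 2)
  convert! h using 1
  have := two_sub_exp_neg_ne_zero hz
  field_simp
  ring

theorem saddlePhase_zero : saddlePhase 0 = 1 := by
  rw [saddlePhase, neg_zero, Complex.exp_zero]
  norm_num

/-- The cubic approximation of the phase, valid on the whole closed right half-plane. -/
theorem norm_saddlePhase_sub_le {z : ℂ} (hz : 0 ≤ z.re) :
    ‖saddlePhase z - 1 - z ^ 3 / 3‖ ≤ 3 * ‖z‖ ^ 4 := by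
  have hd : ∀ w : ℂ, 0 ≤ w.re → HasDerivAt (fun z => saddlePhase z - 1 - z ^ 3 / 3)
      ((1 - Complex.exp (-w)) ^ 2 / (2 - Complex.exp (-w)) - w ^ 2) w := by
    intro w hw
    have h := ((hasDerivAt_saddlePhase hw).sub_const 1).sub ((hasDerivAt_pow 3 w).div_const 3)
    convert! h using 1
    push_cast
    ring
  have := norm_sub_apply_zero_le (C := 3) (n := 3) (by norm_num) hd (fun w hw => ?_) hz
  · simpa [saddlePhase_zero] using this
  · have hne := two_sub_exp_neg_ne_zero hw
    have h1 := norm_one_sub_exp_neg_le hw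
    have h2 := norm_exp_neg_sub_one_add_le hw
    have h3 := one_le_norm_two_sub_exp_neg hw
    set E := Complex.exp (-w)
    have hsplit : (1 - E) ^ 2 / (2 - E) - w ^ 2
        = -((1 - E) ^ 3 / (2 - E)) - (E - 1 + w) * ((1 - E) + w) := by
      field_simp
      ring
    rw [hsplit]
    calc ‖-((1 - E) ^ 3 / (2 - E)) - (E - 1 + w) * ((1 - E) + w)‖
        ≤ ‖1 - E‖ ^ 3 / ‖2 - E‖ + ‖E - 1 + w‖ * ‖(1 - E) + w‖ := by
          refine (norm_sub_le _ _).trans ?_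
          rw [norm_neg, norm_div, norm_pow, norm_mul]
      _ ≤ ‖w‖ ^ 3 + ‖w‖ ^ 2 * (‖w‖ + ‖w‖) := by
          refine add_le_add ?_ ?_
          · exact (div_le_self (by positivity) h3).trans (pow_le_pow_left₀ (norm_nonneg _) h1 3)
          · have h4 : ‖(1 - E) + w‖ ≤ ‖w‖ + ‖w‖ := (norm_add_le _ _).trans (by linarith)
            gcongr
      _ = 3 * ‖w‖ ^ 3 := by ring

/-- On the circle of radius `e^{-ε}/2` the real part of the phase is maximal on the positive axis.
This is `log (1 + b) ≤ b` applied to `|2 - E|² = (2 - ρ)² + 4 (ρ - Re E)`, where `E = e^{-z}` and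
`ρ = |E|`. -/
theorem re_saddlePhase_le {ε : ℝ} (hε : 0 ≤ ε) (θ : ℝ) :
    (saddlePhase (ε + θ * Complex.I)).re ≤ (saddlePhase ε).re
      - (Real.exp (-ε) - Real.exp (-ε) * Real.cos θ) * (1 - 1 / (2 - Real.exp (-ε)) ^ 2) := by
  set ρ := Real.exp (-ε) with hρ
  have hρ1 : ρ ≤ 1 := Real.exp_le_one_iff.2 (by linarith)
  have hE : Complex.exp (-(ε + θ * Complex.I))
      = ((ρ * Real.cos θ : ℝ) : ℂ) + ((-(ρ * Real.sin θ) : ℝ) : ℂ) * Complex.I := by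
    rw [show -((ε : ℂ) + θ * Complex.I) = ((-ε : ℝ) : ℂ) + ((-θ : ℝ) : ℂ) * Complex.I by
      push_cast; ring, Complex.exp_add, Complex.exp_mul_I, ← Complex.ofReal_exp,
      ← Complex.ofReal_cos, ← Complex.ofReal_sin, Real.cos_neg, Real.sin_neg, ← hρ]
    simp only [Complex.ofReal_mul, Complex.ofReal_neg]
    ring
  have hcs := Real.sin_sq_add_cos_sq θ
  generalize Real.cos θ = C at *
  generalize Real.sin θ = S at *
  have hE0 : Complex.exp (-(ε : ℂ)) = (ρ : ℂ) := by rw [hρ]; push_cast; rfl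
  have hn : ‖2 - Complex.exp (-(ε + θ * Complex.I))‖ ^ 2
      = (2 - ρ) ^ 2 + 4 * (ρ - ρ * C) := by
    rw [hE, ← Complex.normSq_eq_norm_sq, Complex.normSq_apply]
    simp
    linear_combination ρ ^ 2 * hcs
  have hpos : 0 < ‖2 - Complex.exp (-(ε + θ * Complex.I))‖ :=
    zero_lt_one.trans_le (one_le_norm_two_sub_exp_neg (by simpa using hε))
  have h2ρ : 0 < 2 - ρ := by linarith
  have hlog : Real.log ‖2 - Complex.exp (-(ε + θ * Complex.I))‖
      ≤ Real.log (2 - ρ) + 2 * (ρ - ρ * C) / (2 - ρ) ^ 2 := by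
    have h1 := Real.log_le_sub_one_of_pos
      (show 0 < ‖2 - Complex.exp (-(ε + θ * Complex.I))‖ ^ 2 / (2 - ρ) ^ 2 by positivity)
    rw [Real.log_div (by positivity) (by positivity), Real.log_pow, Real.log_pow, hn, add_div,
      div_self (by positivity)] at h1
    push_cast at h1
    have h2 : 4 * (ρ - ρ * C) / (2 - ρ) ^ 2
        = 2 * (2 * (ρ - ρ * C) / (2 - ρ) ^ 2) := by ring
    linarith
  have hre : (saddlePhase (ε + θ * Complex.I)).re = ρ * C + ε / 2
      + Real.log ‖2 - Complex.exp (-(ε + θ * Complex.I))‖ / 2 := by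
    have h2 : ∀ z : ℂ, (z / 2).re = z.re / 2 := fun z => by simp
    rw [saddlePhase, Complex.add_re, Complex.add_re, h2, h2, Complex.log_re, hE]
    simp
  have hre0 : (saddlePhase ε).re = ρ + ε / 2 + Real.log (2 - ρ) / 2 := by
    have h2 : ∀ z : ℂ, (z / 2).re = z.re / 2 := fun z => by simp
    have h3 : ‖2 - Complex.exp (-(ε : ℂ))‖ = 2 - ρ := by
      rw [hE0, show (2 : ℂ) - ρ = ((2 - ρ : ℝ) : ℂ) by push_cast; ring, Complex.norm_real,
        Real.norm_of_nonneg h2ρ.le]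
    rw [saddlePhase, Complex.add_re, Complex.add_re, h2, h2, Complex.log_re, h3, hE0]
    simp
  rw [hre, hre0]
  have h5 : (ρ - ρ * C) * (1 - 1 / (2 - ρ) ^ 2)
      = (ρ - ρ * C) - 2 * (ρ - ρ * C) / (2 - ρ) ^ 2 / 2 := by
    field_simp
  rw [h5]
  linarith

/-- The scaling `z = w / m` with `w = 1 + iy`: the Gaussian decay comes from the strict inequality
between the radius and `1/2`. -/
theorem pow_three_mul_re_saddlePhase_le {m y : ℝ} (hm : 2 ≤ m) (hy : |y| ≤ Real.pi * m) :
    m ^ 3 * ((saddlePhase ((1 / m : ℝ) + (y / m : ℝ) * Complex.I)).re - 1)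
      ≤ 4 - y ^ 2 / (2 * Real.pi ^ 2) := by
  have hpi := Real.pi_pos
  have hm0 : 0 < m := by linarith
  set ε := 1 / m with hε
  have hε0 : 0 < ε := by positivity
  have hε2 : ε ≤ 1 / 2 := by rw [hε]; exact one_div_le_one_div_of_le (by norm_num) hm
  have h1 := re_saddlePhase_le hε0.le (y / m)
  have h2 : (saddlePhase ε).re - 1 ≤ 4 * ε ^ 3 := by
    have h3 := norm_saddlePhase_sub_le (z := (ε : ℂ)) (by simpa using hε0.le)
    rw [Complex.norm_real, Real.norm_of_nonneg hε0.le] at h3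
    have h4 := (Complex.re_le_norm _).trans h3
    have h5 : (saddlePhase ε - 1 - (ε : ℂ) ^ 3 / 3).re = (saddlePhase ε).re - 1 - ε ^ 3 / 3 := by
      rw [show (ε : ℂ) ^ 3 / 3 = ((ε ^ 3 / 3 : ℝ) : ℂ) by push_cast; rfl, Complex.sub_re,
        Complex.sub_re, Complex.one_re, Complex.ofReal_re]
    rw [h5] at h4
    have h6 : 0 < ε ^ 3 := by positivity
    nlinarith
  set ρ := Real.exp (-ε) with hρ
  have hρ1 : ρ ≤ 1 - ε / 2 := by
    have h3 : ρ * (1 + ε) ≤ 1 := by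
      have h4 := Real.add_one_le_exp ε
      calc ρ * (1 + ε) ≤ ρ * Real.exp ε := by gcongr; linarith
        _ = 1 := by rw [hρ, ← Real.exp_add]; simp
    nlinarith [Real.exp_pos (-ε)]
  have hρ2 : 1 / 2 ≤ ρ := by
    have := Real.add_one_le_exp (-ε)
    linarith
  have hη : ε / 2 ≤ 1 - 1 / (2 - ρ) ^ 2 := by
    have h3 : 1 / (2 - ρ) ^ 2 ≤ ρ := by
      rw [div_le_iff₀ (by nlinarith)]
      nlinarith [mul_nonneg (show 0 ≤ 1 - ρ by linarith) (show 0 ≤ ρ - 1 / 2 by linarith),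
        mul_nonneg (mul_nonneg (show 0 ≤ 1 - ρ by linarith) (show 0 ≤ 1 - ρ by linarith))
          (show 0 ≤ ρ - 1 / 2 by linarith)]
    linarith
  have hcos : 2 / Real.pi ^ 2 * (y / m) ^ 2 ≤ 1 - Real.cos (y / m) := by
    have := Real.cos_le_one_sub_mul_cos_sq (x := y / m) (by
      rw [abs_div, abs_of_pos hm0]; exact (div_le_iff₀ hm0).2 hy)
    linarith
  have hprod : (1 / 2 * (2 / Real.pi ^ 2 * (y / m) ^ 2)) * (ε / 2)
      ≤ (ρ - ρ * Real.cos (y / m)) * (1 - 1 / (2 - ρ) ^ 2) := by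
    have h3 : ρ - ρ * Real.cos (y / m) = ρ * (1 - Real.cos (y / m)) := by ring
    rw [h3]
    have h4 : 0 ≤ 1 - Real.cos (y / m) := by linarith [Real.cos_le_one (y / m)]
    gcongr
  have hfin : (saddlePhase (ε + (y / m : ℝ) * Complex.I)).re - 1
      ≤ 4 * ε ^ 3 - (1 / 2 * (2 / Real.pi ^ 2 * (y / m) ^ 2)) * (ε / 2) := by linarith
  calc m ^ 3 * ((saddlePhase (ε + (y / m : ℝ) * Complex.I)).re - 1)
      ≤ m ^ 3 * (4 * ε ^ 3 - (1 / 2 * (2 / Real.pi ^ 2 * (y / m) ^ 2)) * (ε / 2)) := by gcongr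
    _ = 4 - y ^ 2 / (2 * Real.pi ^ 2) := by
        rw [hε]; field_simp

/-! ### The rescaled one-variable factor -/

/-- The exponent of the rescaled one-variable factor at the point `u = e^{-w/m}/2`. -/
noncomputable def scaledExponent (m α x : ℝ) (w : ℂ) : ℂ :=
  m ^ 3 * (saddlePhase (w / m) - 1) + m * x * (Complex.exp (-(w / m)) - 1) - w / m
    + α * Complex.log (2 - Complex.exp (-(w / m)))

theorem circleWeight_half_exp {N : ℕ} {m α x : ℝ} (hm : 0 < m) (hmN : m ^ 3 = 2 * N) {w : ℂ}
    (hw : 0 ≤ w.re) :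
    circleWeight N (N + α) (4 * N * (1 + x / m ^ 2)) (Complex.exp (-(w / m)) / 2)
      = ((Real.exp (2 * N + m * x) * 2 ^ (-1 - α) : ℝ) : ℂ)
        * Complex.exp (scaledExponent m α x w) := by
  have hz : 0 ≤ (w / m).re := by
    rw [Complex.div_ofReal_re]; positivity
  have hne := two_sub_exp_neg_ne_zero hz
  have hmC : (m : ℂ) ≠ 0 := by exact_mod_cast hm.ne'
  have hN : (N : ℂ) = (m : ℂ) ^ 3 / 2 := by
    have : ((m ^ 3 : ℝ) : ℂ) = ((2 * N : ℝ) : ℂ) := by rw [hmN]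
    push_cast at this
    rw [this]; ring
  have hu : Complex.exp (-(w / m)) / 2 = Complex.exp (-(w / m) - (Real.log 2 : ℝ)) := by
    rw [Complex.exp_sub, ← Complex.ofReal_exp, Real.exp_log (by norm_num)]; norm_num
  have hlog : Complex.log (1 - Complex.exp (-(w / m)) / 2)
      = Complex.log (2 - Complex.exp (-(w / m))) - (Real.log 2 : ℝ) := by
    rw [show 1 - Complex.exp (-(w / m)) / 2
      = ((1 / 2 : ℝ) : ℂ) * (2 - Complex.exp (-(w / m))) by push_cast; ring,
      Complex.log_ofReal_mul (by norm_num) hne, one_div, Real.log_inv]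
    push_cast; ring
  have h2 : ((Real.exp (2 * N + m * x) * 2 ^ (-1 - α) : ℝ) : ℂ)
      = Complex.exp ((m : ℂ) ^ 3 + m * x + (Real.log 2 : ℝ) * (-1 - α)) := by
    rw [Real.rpow_def_of_pos (by norm_num), ← Real.exp_add, Complex.ofReal_exp]
    congr 1
    push_cast
    rw [hN]; ring
  have hpow : (Complex.exp (-(w / m) - (Real.log 2 : ℝ)) ^ N)⁻¹
      = Complex.exp ((N : ℂ) * (w / m + (Real.log 2 : ℝ))) := by
    rw [← Complex.exp_nat_mul, ← Complex.exp_neg]; congr 1; ring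
  rw [circleWeight, hlog, h2, ← Complex.exp_add]
  nth_rewrite 2 3 [hu]
  rw [hpow, ← Complex.exp_add, ← Complex.exp_add, ← Complex.exp_add, scaledExponent, saddlePhase]
  congr 1
  push_cast
  rw [hN]
  field_simp
  ring

theorem norm_exp_sub_exp_le {A B : ℂ} {r : ℝ} (hA : A.re ≤ r) (hB : B.re ≤ r) :
    ‖Complex.exp A - Complex.exp B‖ ≤ Real.exp r * ‖A - B‖ := by
  refine (convex_halfSpace_re_le r).norm_image_sub_le_of_norm_hasDerivWithin_le
    (fun z _ => (Complex.hasDerivAt_exp z).hasDerivWithinAt) (fun z hz => ?_) hB hA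
  rw [Complex.norm_exp]
  exact Real.exp_le_exp.2 hz

theorem norm_one_add_mul_I_le (y : ℝ) : ‖(1 : ℂ) + y * Complex.I‖ ≤ 1 + |y| := by
  refine (norm_add_le _ _).trans ?_
  simp

/-- The exponent of the rescaled factor differs from that of the Airy factor by `O(1/m)`. -/
theorem norm_scaledExponent_sub_le {m : ℝ} (hm : 1 ≤ m) (α x y : ℝ) :
    ‖scaledExponent m α x (1 + y * Complex.I)
        - ((1 + y * Complex.I) ^ 3 / 3 - x * (1 + y * Complex.I))‖
      ≤ 1 / m * ((4 + |x| + |α|) * (1 + |y|) ^ 4) := by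
  have hm0 : 0 < m := by linarith
  have hmC : (m : ℂ) ≠ 0 := by exact_mod_cast hm0.ne'
  set w : ℂ := 1 + y * Complex.I with hw
  have hwre : 0 ≤ w.re := by simp [hw]
  have hwn : ‖w‖ ≤ 1 + |y| := norm_one_add_mul_I_le y
  set z := w / m with hz
  have hzre : 0 ≤ z.re := by rw [hz, Complex.div_ofReal_re]; positivity
  have hzn : ‖z‖ = ‖w‖ / m := by
    rw [hz, norm_div, Complex.norm_real, Real.norm_of_nonneg hm0.le]
  have hsplit : scaledExponent m α x w - (w ^ 3 / 3 - x * w)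
      = m ^ 3 * (saddlePhase z - 1 - z ^ 3 / 3) + m * x * (Complex.exp (-z) - 1 + z) - z
        + α * Complex.log (2 - Complex.exp (-z)) := by
    have hwz : w = m * z := by rw [hz]; field_simp
    rw [scaledExponent, ← hz, hwz]
    ring
  have h1 := norm_saddlePhase_sub_le hzre
  have h2 := norm_exp_neg_sub_one_add_le hzre
  have h3 := norm_log_two_sub_exp_neg_le hzre
  have hY : 1 ≤ 1 + |y| := by linarith [abs_nonneg y]
  have p1 : ‖w‖ ≤ (1 + |y|) ^ 4 := hwn.trans (le_self_pow₀ hY (by norm_num))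
  have p2 : ‖w‖ ^ 2 ≤ (1 + |y|) ^ 4 :=
    (pow_le_pow_left₀ (norm_nonneg _) hwn 2).trans (pow_le_pow_right₀ hY (by norm_num))
  have p4 : ‖w‖ ^ 4 ≤ (1 + |y|) ^ 4 := pow_le_pow_left₀ (norm_nonneg _) hwn 4
  rw [hsplit]
  calc _ ≤ m ^ 3 * (3 * ‖z‖ ^ 4) + m * |x| * ‖z‖ ^ 2 + ‖z‖ + |α| * ‖z‖ := by
        refine (norm_add_le _ _).trans (add_le_add ((norm_sub_le _ _).trans
          (add_le_add ((norm_add_le _ _).trans (add_le_add ?_ ?_)) le_rfl)) ?_)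
        · rw [norm_mul, norm_pow, Complex.norm_real, Real.norm_of_nonneg hm0.le]
          gcongr
        · rw [norm_mul, norm_mul, Complex.norm_real, Complex.norm_real,
            Real.norm_of_nonneg hm0.le, Real.norm_eq_abs]
          gcongr
        · rw [norm_mul, Complex.norm_real, Real.norm_eq_abs]
          gcongr
    _ = 1 / m * (3 * ‖w‖ ^ 4 + |x| * ‖w‖ ^ 2 + ‖w‖ + |α| * ‖w‖) := by
        rw [hzn]; field_simp
    _ ≤ 1 / m * (3 * (1 + |y|) ^ 4 + |x| * (1 + |y|) ^ 4 + (1 + |y|) ^ 4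
          + |α| * (1 + |y|) ^ 4) := by gcongr
    _ = _ := by ring

theorem re_scaledExponent_le {m α x y : ℝ} (hm : 2 ≤ m) (hmx : 2 * Real.pi ^ 2 * |x| ≤ m)
    (hy : |y| ≤ Real.pi * m) :
    (scaledExponent m α x (1 + y * Complex.I)).re
      ≤ (4 + |x| + 5 * |α|) + -(1 / (4 * Real.pi ^ 2)) * y ^ 2 := by
  have hpi := Real.pi_pos
  have hm0 : 0 < m := by linarith
  have hmC : (m : ℂ) ≠ 0 := by exact_mod_cast hm0.ne'
  have hz : (1 + y * Complex.I) / (m : ℂ) = (1 / m : ℝ) + (y / m : ℝ) * Complex.I := by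
    push_cast; field_simp
  have h1 := pow_three_mul_re_saddlePhase_le hm hy
  set z : ℂ := (1 / m : ℝ) + (y / m : ℝ) * Complex.I with hzdef
  have hzre' : z.re = 1 / m := by simp [hzdef]
  have hzim' : z.im = y / m := by simp [hzdef]
  have hzre : 0 ≤ z.re := by rw [hzre']; positivity
  have h2 : ‖Complex.log (2 - Complex.exp (-z))‖ ≤ 5 := by
    refine (norm_log_two_sub_exp_neg_le hzre).trans ((Complex.norm_le_abs_re_add_abs_im z).trans ?_)
    rw [hzre', hzim', abs_div, abs_div, abs_of_pos hm0, abs_one]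
    have e1 : 1 / m ≤ 1 := by rw [div_le_one hm0]; linarith
    have e2 : |y| / m ≤ Real.pi := (div_le_iff₀ hm0).2 hy
    linarith [Real.pi_le_four]
  have h3 : -(1 / m + (y / m) ^ 2 / 2) ≤ (Complex.exp (-z) - 1).re := by
    rw [Complex.sub_re, Complex.exp_re, Complex.neg_re, Complex.neg_im, Real.cos_neg, hzre', hzim',
      Complex.one_re]
    have e1 := Real.add_one_le_exp (-(1 / m))
    have e2 := Real.one_sub_sq_div_two_le_cos (x := y / m)
    have e3 : Real.exp (-(1 / m)) ≤ 1 := Real.exp_le_one_iff.2 (by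
      rw [neg_nonpos]; positivity)
    have e4 := Real.cos_le_one (y / m)
    nlinarith [Real.exp_pos (-(1 / m))]
  have h3' : (Complex.exp (-z) - 1).re ≤ 0 := by
    have := (Complex.re_le_norm _).trans (norm_exp_neg_le_one hzre)
    rw [Complex.sub_re, Complex.one_re]; linarith
  have h4 : m * x * (Complex.exp (-z) - 1).re ≤ |x| + 1 / (4 * Real.pi ^ 2) * y ^ 2 := by
    have e1 : x * (Complex.exp (-z) - 1).re ≤ |x| * (1 / m + (y / m) ^ 2 / 2) := by
      refine (le_abs_self _).trans ?_
      rw [abs_mul, abs_of_nonpos h3']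
      gcongr
      linarith
    have e2 : |x| / (2 * m) ≤ 1 / (4 * Real.pi ^ 2) := by
      rw [div_le_div_iff₀ (by positivity) (by positivity)]
      linarith
    calc m * x * (Complex.exp (-z) - 1).re ≤ m * (|x| * (1 / m + (y / m) ^ 2 / 2)) := by
          rw [mul_assoc]; gcongr
      _ = |x| + |x| / (2 * m) * y ^ 2 := by field_simp
      _ ≤ _ := by gcongr
  have h5 : α * (Complex.log (2 - Complex.exp (-z))).re ≤ 5 * |α| := by
    refine (le_abs_self _).trans ?_
    rw [abs_mul, mul_comm]
    gcongr
    exact (Complex.abs_re_le_norm _).trans h2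
  have hre : (scaledExponent m α x (1 + y * Complex.I)).re
      = m ^ 3 * ((saddlePhase z).re - 1) + m * x * (Complex.exp (-z) - 1).re - z.re
        + α * (Complex.log (2 - Complex.exp (-z))).re := by
    rw [scaledExponent, hz, ← Complex.ofReal_pow, ← Complex.ofReal_mul, Complex.add_re,
      Complex.sub_re, Complex.add_re, Complex.re_ofReal_mul, Complex.re_ofReal_mul,
      Complex.re_ofReal_mul, Complex.sub_re, Complex.one_re]
  rw [hre]
  have h6 : y ^ 2 / (2 * Real.pi ^ 2)
      = 1 / (4 * Real.pi ^ 2) * y ^ 2 + 1 / (4 * Real.pi ^ 2) * y ^ 2 := by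
    field_simp; ring
  linarith

/-- The rescaled one-variable factor, extended by zero beyond `|y| ≤ π m`. -/
noncomputable def scaledFactor (m α x : ℝ) : ℝ → ℂ :=
  Set.indicator {t : ℝ | |t| ≤ Real.pi * m}
    fun t => Complex.exp (scaledExponent m α x (1 + t * Complex.I))

/-- The common Gaussian majorant of the rescaled factors and of the Airy factor. -/
noncomputable def gaussianMajorant (α x y : ℝ) : ℝ :=
  Real.exp (4 + |x| + 5 * |α|) * (5 + |x| + |α|)
    * ((1 + |y|) ^ 4 * Real.exp (-(1 / (4 * Real.pi ^ 2)) * y ^ 2))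

theorem exp_gaussian_le_gaussianMajorant (α x y : ℝ) :
    Real.exp ((4 + |x| + 5 * |α|) + -(1 / (4 * Real.pi ^ 2)) * y ^ 2)
      ≤ gaussianMajorant α x y := by
  have h1 : 1 ≤ (5 + |x| + |α|) * (1 + |y|) ^ 4 :=
    one_le_mul_of_one_le_of_one_le (by linarith [abs_nonneg x, abs_nonneg α])
      (one_le_pow₀ (by linarith [abs_nonneg y]))
  rw [Real.exp_add, gaussianMajorant]
  have h2 := Real.exp_pos (4 + |x| + 5 * |α|)
  have h3 := Real.exp_pos (-(1 / (4 * Real.pi ^ 2)) * y ^ 2)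
  calc _ = Real.exp (4 + |x| + 5 * |α|) * Real.exp (-(1 / (4 * Real.pi ^ 2)) * y ^ 2) * 1 := by ring
    _ ≤ Real.exp (4 + |x| + 5 * |α|) * Real.exp (-(1 / (4 * Real.pi ^ 2)) * y ^ 2)
          * ((5 + |x| + |α|) * (1 + |y|) ^ 4) := by gcongr
    _ = _ := by ring

theorem re_airyExponent_le (α x y : ℝ) :
    ((1 + y * Complex.I) ^ 3 / 3 - x * (1 + y * Complex.I) : ℂ).re
      ≤ (4 + |x| + 5 * |α|) + -(1 / (4 * Real.pi ^ 2)) * y ^ 2 := by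
  have h := norm_airyWeight x 1 y
  rw [airyWeight, Complex.norm_exp, Real.exp_eq_exp, Complex.ofReal_one] at h
  rw [h]
  have h1 : 1 / (4 * Real.pi ^ 2) ≤ 1 := by
    rw [div_le_one (by positivity)]
    nlinarith [Real.pi_gt_three]
  have h2 : 1 / (4 * Real.pi ^ 2) * y ^ 2 ≤ 1 * y ^ 2 := by gcongr
  linarith [neg_abs_le x, abs_nonneg α]

theorem norm_airyWeight_one_le (α x y : ℝ) :
    ‖airyWeight x (1 + y * Complex.I)‖ ≤ gaussianMajorant α x y := by
  rw [airyWeight, Complex.norm_exp]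
  exact (Real.exp_le_exp.2 (re_airyExponent_le α x y)).trans
    (exp_gaussian_le_gaussianMajorant α x y)

theorem norm_scaledFactor_le {m α x : ℝ} (hm : 2 ≤ m) (hmx : 2 * Real.pi ^ 2 * |x| ≤ m) (y : ℝ) :
    ‖scaledFactor m α x y‖ ≤ gaussianMajorant α x y := by
  by_cases hy : |y| ≤ Real.pi * m
  · rw [scaledFactor, Set.indicator_of_mem (show y ∈ {t : ℝ | |t| ≤ Real.pi * m} from hy),
      Complex.norm_exp]
    exact (Real.exp_le_exp.2 (re_scaledExponent_le hm hmx hy)).trans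
      (exp_gaussian_le_gaussianMajorant α x y)
  · rw [scaledFactor, Set.indicator_of_notMem (show y ∉ {t : ℝ | |t| ≤ Real.pi * m} from hy),
      norm_zero]
    unfold gaussianMajorant
    positivity

/-- The rescaled factor converges to the Airy factor at rate `1/m`, relative to the Gaussian
majorant. -/
theorem norm_scaledFactor_sub_airyWeight_le {m α x : ℝ} (hm : 2 ≤ m)
    (hmx : 2 * Real.pi ^ 2 * |x| ≤ m) (y : ℝ) :
    ‖scaledFactor m α x y - airyWeight x (1 + y * Complex.I)‖
      ≤ 1 / m * gaussianMajorant α x y := by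
  have hm0 : 0 < m := by linarith
  have hY : 1 ≤ 1 + |y| := by linarith [abs_nonneg y]
  by_cases hy : |y| ≤ Real.pi * m
  · rw [scaledFactor, Set.indicator_of_mem (show y ∈ {t : ℝ | |t| ≤ Real.pi * m} from hy),
      airyWeight]
    refine (norm_exp_sub_exp_le (re_scaledExponent_le hm hmx hy)
      (re_airyExponent_le α x y)).trans ?_
    refine (mul_le_mul_of_nonneg_left (norm_scaledExponent_sub_le (by linarith) α x y)
      (Real.exp_pos _).le).trans ?_
    rw [Real.exp_add, gaussianMajorant]
    calc _ = 1 / m * (Real.exp (4 + |x| + 5 * |α|) * (4 + |x| + |α|)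
          * ((1 + |y|) ^ 4 * Real.exp (-(1 / (4 * Real.pi ^ 2)) * y ^ 2))) := by ring
      _ ≤ _ := by gcongr; norm_num
  · -- beyond the range of the circle `|y| / m > 1`, so the Airy factor is itself small enough
    rw [scaledFactor, Set.indicator_of_notMem (show y ∉ {t : ℝ | |t| ≤ Real.pi * m} from hy),
      zero_sub, norm_neg, airyWeight, Complex.norm_exp]
    refine (Real.exp_le_exp.2 (re_airyExponent_le α x y)).trans ?_
    have hym : m ≤ (1 + |y|) ^ 4 := by
      push Not at hy
      have h1 : m ≤ 1 + |y| := by nlinarith [Real.pi_gt_three]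
      exact h1.trans (le_self_pow₀ hY (by norm_num))
    have h1 : 1 ≤ 1 / m * ((5 + |x| + |α|) * (1 + |y|) ^ 4) := by
      rw [one_div, ← div_eq_inv_mul, le_div_iff₀ hm0, one_mul]
      exact hym.trans (le_mul_of_one_le_left (by positivity)
        (by linarith [abs_nonneg x, abs_nonneg α]))
    rw [Real.exp_add, gaussianMajorant]
    calc _ = Real.exp (4 + |x| + 5 * |α|) * Real.exp (-(1 / (4 * Real.pi ^ 2)) * y ^ 2) * 1 := by
          ring
      _ ≤ Real.exp (4 + |x| + 5 * |α|) * Real.exp (-(1 / (4 * Real.pi ^ 2)) * y ^ 2)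
          * (1 / m * ((5 + |x| + |α|) * (1 + |y|) ^ 4)) := by gcongr
      _ = _ := by ring

theorem measurable_scaledFactor (m α x : ℝ) : Measurable (scaledFactor m α x) := by
  refine Measurable.indicator ?_ (measurableSet_le (by fun_prop) measurable_const)
  unfold scaledExponent saddlePhase
  fun_prop

/-! ### The soft edge expansion -/

/-- The rescaled integral on the shrunken circles: the torus integral of the circle factor is the
saddle point value times an integral of rescaled factors. -/
theorem rIntegral_eq_scaled {β : ℕ} (hβ : 0 < β) {a x m : ℝ} (ha : 0 ≤ a) {N : ℕ} (hN : 2 ≤ N)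
    (hm : 0 < m) (hmN : m ^ 3 = 2 * N) :
    rIntegral (laguerreF a N β) N β (1 + x / m ^ 2) = Complex.I ^ β
      * ((m ^ (2 - 3 * (β : ℝ))
          * (Real.exp (2 * N + m * x) * 2 ^ (-1 - (a - 2 + 2 / β))) ^ β : ℝ) : ℂ)
      * ∫ y : Fin β → ℝ, (∏ j, scaledFactor m (a - 2 + 2 / β) x (y j))
        * (interaction β (fun j => (m : ℂ) * Complex.exp ((-y j / m : ℝ) * Complex.I)) : ℂ) := by
  set α : ℝ := a - 2 + 2 / β with hα
  -- from `N = 2` on, the factor `(1 - u) ^ M` is bounded on the closed disc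
  have hM : 0 ≤ (N : ℝ) + a - 2 + 2 / β := by
    have h1 : (2 : ℝ) ≤ N := by exact_mod_cast hN
    have h2 : (0 : ℝ) ≤ 2 / β := by positivity
    linarith
  have hMα : (N : ℝ) + a - 2 + 2 / β = N + α := by rw [hα]; ring
  -- `e^w` is the radius `e^{-1/m}/2`, just inside the saddle point `1/2`
  set w : ℂ := ((-(1 / m) - Real.log 2 : ℝ) : ℂ) with hw
  have hw0 : w.re < 0 := by
    rw [hw, Complex.ofReal_re]
    have h1 := Real.log_pos (show (1 : ℝ) < 2 by norm_num)
    have h2 : 0 < 1 / m := by positivity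
    linarith
  have hζ : Complex.exp w = Complex.exp (-(1 / m : ℝ)) / 2 := by
    rw [hw, ← Complex.ofReal_exp, Real.exp_sub, Real.exp_log (by norm_num)]
    push_cast; rfl
  have hfac : ∀ t : ℝ, Set.indicator {t : ℝ | |t| ≤ Real.pi * m}
        (fun t : ℝ => circleWeight N (N + α) (4 * N * (1 + x / m ^ 2))
          (Complex.exp w * Complex.exp ((-t / m : ℝ) * Complex.I))) t
      = ((Real.exp (2 * N + m * x) * 2 ^ (-1 - α) : ℝ) : ℂ) * scaledFactor m α x t := by
    intro t
    have hpt : Complex.exp w * Complex.exp ((-t / m : ℝ) * Complex.I)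
        = Complex.exp (-((1 + t * Complex.I) / m)) / 2 := by
      rw [hζ, div_mul_eq_mul_div, ← Complex.exp_add]
      congr 2
      push_cast; ring
    rw [scaledFactor]
    by_cases ht : t ∈ {t : ℝ | |t| ≤ Real.pi * m}
    · rw [Set.indicator_of_mem ht, Set.indicator_of_mem ht, hpt,
        circleWeight_half_exp hm hmN (by simp)]
    · rw [Set.indicator_of_notMem ht, Set.indicator_of_notMem ht, mul_zero]
  rw [rIntegral_laguerreF (by omega), integral_torusIntegrand_circleWeight hM hw0,
    integral_torusIntegrand_eq_integral_indicator hβ (measurable_circleWeight _ _ _) _ hm, hMα]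
  simp only [hfac, Finset.prod_mul_distrib, Finset.prod_const, Finset.card_univ, Fintype.card_fin,
    mul_assoc (_ ^ β : ℂ)]
  rw [integral_const_mul]
  push_cast
  ring

theorem norm_sub_exp_mul_I (s t : ℝ) :
    ‖Complex.exp (s * Complex.I) - Complex.exp (t * Complex.I)‖
      = ‖Complex.exp ((s - t : ℝ) * Complex.I) - 1‖ := by
  have h : Complex.exp (s * Complex.I) - Complex.exp (t * Complex.I)
      = Complex.exp (t * Complex.I) * (Complex.exp ((s - t : ℝ) * Complex.I) - 1) := by
    rw [mul_sub, ← Complex.exp_add, mul_one]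
    congr 2
    push_cast; ring
  rw [h, norm_mul, Complex.norm_exp_ofReal_mul_I, one_mul]

theorem norm_exp_mul_I_sub_one_le (t : ℝ) : ‖Complex.exp (t * Complex.I) - 1‖ ≤ |t| := by
  rw [mul_comm]
  exact Real.norm_exp_I_mul_ofReal_sub_one_le

theorem abs_sub_norm_exp_mul_I_sub_one_le (t : ℝ) :
    |t| - ‖Complex.exp (t * Complex.I) - 1‖ ≤ |t| ^ 2 := by
  rcases le_total |t| 1 with h | h
  · have hn : ‖(t : ℂ) * Complex.I‖ = |t| := by simp
    have h1 := Complex.norm_exp_sub_one_sub_id_le (x := t * Complex.I) (by rw [hn]; exact h)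
    have h2 := norm_sub_norm_le ((t : ℂ) * Complex.I) (Complex.exp (t * Complex.I) - 1)
    rw [norm_sub_rev ((t : ℂ) * Complex.I)] at h2
    rw [hn] at h1 h2
    linarith
  · nlinarith [norm_nonneg (Complex.exp (t * Complex.I) - 1)]

/-- Chords of the circle of radius `m` approximate arcs from below, with relative error `O(1/m)`
in the interaction. -/
theorem abs_interaction_chord_sub_le {β : ℕ} (hβ : 2 ≤ β) {m : ℝ} (hm : 0 < m) (y : Fin β → ℝ) :
    interaction β (fun j => (m : ℂ) * Complex.exp ((-y j / m : ℝ) * Complex.I))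
        ≤ polyWeight y ^ interactionDegree β ∧
    |interaction β (fun j => (m : ℂ) * Complex.exp ((-y j / m : ℝ) * Complex.I))
        - interaction β (fun j => (y j : ℂ) * Complex.I)|
      ≤ interactionDegree β * (2 * (1 / m)) * polyWeight y ^ interactionDegree β := by
  have hchord : ∀ j k, ‖(m : ℂ) * Complex.exp ((-y j / m : ℝ) * Complex.I)
        - m * Complex.exp ((-y k / m : ℝ) * Complex.I)‖
      = m * ‖Complex.exp ((-y j / m - -y k / m : ℝ) * Complex.I) - 1‖ := by
    intro j k
    rw [← mul_sub, norm_mul, Complex.norm_real, Real.norm_of_nonneg hm.le, norm_sub_exp_mul_I]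
  have habs : ∀ j k, m * |-y j / m - -y k / m| = |y j - y k| := by
    intro j k
    rw [← abs_of_pos hm, ← abs_mul, abs_of_pos hm, abs_sub_comm (y j)]
    congr 1
    field_simp
    ring
  have hle : ∀ j k, ‖(m : ℂ) * Complex.exp ((-y j / m : ℝ) * Complex.I)
      - m * Complex.exp ((-y k / m : ℝ) * Complex.I)‖ ≤ |y j - y k| := by
    intro j k
    rw [hchord, ← habs]
    exact mul_le_mul_of_nonneg_left (norm_exp_mul_I_sub_one_le _) hm.le
  refine ⟨interaction_le hβ hle, abs_interaction_sub_le hβ (by positivity)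
    (fun j k => norm_sub_mul_I _ _) hle fun j k => ?_⟩
  rw [hchord, ← habs, ← mul_sub]
  calc _ ≤ m * |-y j / m - -y k / m| ^ 2 :=
        mul_le_mul_of_nonneg_left (abs_sub_norm_exp_mul_I_sub_one_le _) hm.le
    _ = _ := by field_simp

/-- The rescaled integrals converge to the Kontsevich type integral at rate `1/m`. -/
theorem norm_integral_scaled_sub_le {β : ℕ} (hβ : 2 ≤ β) (α x : ℝ) : ∃ C : ℝ, ∀ m : ℝ, 2 ≤ m →
    2 * Real.pi ^ 2 * |x| ≤ m →
    ‖(∫ y : Fin β → ℝ, (∏ j, scaledFactor m α x (y j))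
        * (interaction β (fun j => (m : ℂ) * Complex.exp ((-y j / m : ℝ) * Complex.I)) : ℂ))
      - ∫ y, airyShift β x 1 y‖ ≤ C * (1 / m) := by
  set G : (Fin β → ℝ) → ℝ := fun y =>
    (∏ j, gaussianMajorant α x (y j)) * polyWeight y ^ interactionDegree β with hG
  have hGi : Integrable G := integrable_prod_gaussian_mul_polyWeight _ 4 _ (by positivity)
  refine ⟨∫ y, ((β : ℝ) + 2 * interactionDegree β) * G y, fun m hm hmx => ?_⟩
  have hm0 : 0 < m := by linarith
  set W : (Fin β → ℝ) → ℝ := fun y =>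
    interaction β (fun j => (m : ℂ) * Complex.exp ((-y j / m : ℝ) * Complex.I)) with hW
  have hW0 : ∀ y, 0 ≤ W y := fun y => interaction_nonneg _ _
  have hgm : ∀ y, 0 ≤ gaussianMajorant α x y := fun y => by unfold gaussianMajorant; positivity
  have hP : ∀ y : Fin β → ℝ, ‖∏ j, scaledFactor m α x (y j)‖ ≤ ∏ j, gaussianMajorant α x (y j) :=
    fun y => by
      rw [norm_prod]
      exact Finset.prod_le_prod (fun _ _ => norm_nonneg _)
        fun j _ => norm_scaledFactor_le hm hmx (y j)
  have hK : ∀ y : Fin β → ℝ, ‖∏ j, airyWeight x (1 + y j * Complex.I)‖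
      ≤ ∏ j, gaussianMajorant α x (y j) := fun y => by
    rw [norm_prod]
    exact Finset.prod_le_prod (fun _ _ => norm_nonneg _)
      fun j _ => norm_airyWeight_one_le α x (y j)
  have hint : Integrable fun y : Fin β → ℝ => (∏ j, scaledFactor m α x (y j)) * (W y : ℂ) := by
    refine hGi.mono' ?_ (Eventually.of_forall fun y => ?_)
    · have h1 := measurable_scaledFactor m α x
      have hI := (continuous_interaction β).measurable
      refine Measurable.aestronglyMeasurable (Measurable.mul ?_ ?_)
      · exact Finset.measurable_prod _ fun j _ => by fun_prop
      · exact Complex.measurable_ofReal.comp (hI.comp (by fun_prop))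
    · rw [norm_mul, Complex.norm_real, Real.norm_of_nonneg (hW0 y)]
      exact mul_le_mul (hP y) (abs_interaction_chord_sub_le hβ hm0 y).1 (hW0 y)
        (Finset.prod_nonneg fun _ _ => hgm _)
  rw [← integral_sub hint (integrable_airyShift hβ x (by simp)), mul_comm, ← integral_const_mul]
  refine norm_integral_le_of_norm_le ((hGi.const_mul _).const_mul _)
    (Eventually.of_forall fun y => ?_)
  have hprod := norm_prod_sub_prod_le Finset.univ (fun j => scaledFactor m α x (y j))
    (fun j => airyWeight x (1 + y j * Complex.I)) (fun j => gaussianMajorant α x (y j))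
    (η := 1 / m) (by positivity) (fun j _ => norm_scaledFactor_le hm hmx (y j))
    (fun j _ => norm_airyWeight_one_le α x (y j))
    (fun j _ => norm_scaledFactor_sub_airyWeight_le hm hmx (y j))
  rw [Finset.card_univ, Fintype.card_fin] at hprod
  obtain ⟨hWle, hWsub⟩ := abs_interaction_chord_sub_le hβ hm0 y
  rw [airyShift]
  set P := ∏ j, scaledFactor m α x (y j)
  set K := ∏ j, airyWeight x (1 + y j * Complex.I)
  set V := interaction β (fun j => (y j : ℂ) * Complex.I)
  have hsplit : P * (W y : ℂ) - K * (V : ℂ) = (P - K) * (W y : ℂ) + K * ((W y - V : ℝ) : ℂ) := by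
    push_cast; ring
  rw [hsplit]
  calc ‖(P - K) * (W y : ℂ) + K * ((W y - V : ℝ) : ℂ)‖
      ≤ ‖P - K‖ * W y + ‖K‖ * |W y - V| := by
        refine (norm_add_le _ _).trans ?_
        rw [norm_mul, norm_mul, Complex.norm_real, Complex.norm_real,
          Real.norm_of_nonneg (hW0 y), Real.norm_eq_abs]
    _ ≤ (β * (1 / m) * ∏ j, gaussianMajorant α x (y j)) * polyWeight y ^ interactionDegree β
        + (∏ j, gaussianMajorant α x (y j)) * (interactionDegree β * (2 * (1 / m))
          * polyWeight y ^ interactionDegree β) := by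
        have h0 : 0 ≤ ∏ j, gaussianMajorant α x (y j) := Finset.prod_nonneg fun _ _ => hgm _
        refine add_le_add (mul_le_mul hprod hWle (hW0 y) (by positivity))
          (mul_le_mul (hK y) hWsub (abs_nonneg _) h0)
    _ = 1 / m * ((β + 2 * interactionDegree β) * G y) := by rw [hG]; ring

/-- Collecting the powers of `2` and `N`: the Jacobian, the homogeneity of the interaction and the
value of the integrand at the saddle point. -/
theorem saddle_constant_eq {β : ℕ} (hβ : 0 < β) (a x : ℝ) {N : ℕ} (hN : 0 < N) {m : ℝ}
    (hm : m = (2 * (N : ℝ)) ^ (1 / 3 : ℝ)) :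
    m ^ (2 - 3 * (β : ℝ)) * (Real.exp (2 * N + m * x) * 2 ^ (-1 - (a - 2 + 2 / β))) ^ β
      = Real.exp (2 * β * N + β * m * x)
        / (2 ^ (a * β + 4 / 3) * (N : ℝ) ^ ((β : ℝ) - 2 / 3)) := by
  have hN0 : (0 : ℝ) < N := by exact_mod_cast hN
  have hb : (β : ℝ) ≠ 0 := by positivity
  have h1 : m ^ (2 - 3 * (β : ℝ)) = 2 ^ (2 / 3 - (β : ℝ)) * (N : ℝ) ^ (2 / 3 - (β : ℝ)) := by
    rw [hm, ← Real.rpow_mul (by positivity), Real.mul_rpow (by norm_num) hN0.le]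
    congr 2 <;> ring
  have h2 : ((2 : ℝ) ^ (-1 - (a - 2 + 2 / (β : ℝ)))) ^ β = 2 ^ ((β : ℝ) - a * β - 2) := by
    rw [← Real.rpow_natCast, ← Real.rpow_mul (by norm_num)]
    congr 1
    field_simp
    ring
  have h3 : Real.exp (2 * N + m * x) ^ β = Real.exp (2 * β * N + β * m * x) := by
    rw [← Real.exp_nat_mul]; congr 1; ring
  have h4 : (2 : ℝ) ^ (2 / 3 - (β : ℝ)) * 2 ^ ((β : ℝ) - a * β - 2)
      = (2 ^ (a * β + 4 / 3))⁻¹ := by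
    rw [← Real.rpow_add (by norm_num), ← Real.rpow_neg (by norm_num)]
    congr 1; ring
  have h5 : (N : ℝ) ^ (2 / 3 - (β : ℝ)) = ((N : ℝ) ^ ((β : ℝ) - 2 / 3))⁻¹ := by
    rw [← Real.rpow_neg hN0.le]; congr 1; ring
  rw [mul_pow, h1, h2, h3, h5, div_eq_mul_inv (Real.exp _), mul_inv, ← h4]
  ring

theorem mainTheorem8 (β : ℕ) (hβ_pos : 0 < β) (hβ : Even β) (a : ℝ) (ha : 0 ≤ a) (x : ℝ) :
    -- the integrals `R_{N,β}` converge absolutely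
    (∀ N : ℕ, 1 ≤ N → ∀ t : ℝ,
      TorusIntegrable (rIntegrand (laguerreF a N β) N β t) (fun _ => 0) (fun _ => 1)) ∧
    -- the integrals along `Re v = c`, `c > 0`, converge absolutely, with common value `K_{β,β}(x)`
    (∀ c : ℝ, 0 < c →
      Integrable (fun y : Fin β → ℝ => kontsevichIntegrand β x (verticalPoint β c y)) ∧
      kontsevichLine β c x = kontsevichK β x) ∧
    -- the soft edge expansion
    (fun N : ℕ =>
        rIntegral (laguerreF a N β) N β (1 + x / (2 * (N : ℝ)) ^ (2 / 3 : ℝ))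
          - (2 * (Real.pi : ℂ) * Complex.I) ^ β
            * ((Real.exp (2 * β * N + β * (2 * (N : ℝ)) ^ (1 / 3 : ℝ) * x)
                / ((2 : ℝ) ^ (a * β + 4 / 3) * (N : ℝ) ^ ((β : ℝ) - 2 / 3)) : ℝ) : ℂ)
            * kontsevichK β x)
      =O[atTop]
    (fun N : ℕ =>
        Real.exp (2 * β * N + β * (2 * (N : ℝ)) ^ (1 / 3 : ℝ) * x)
          * (N : ℝ) ^ (-(β : ℝ) + 1 / 3)) := by
  have hβ2 : 2 ≤ β := by
    obtain ⟨k, rfl⟩ := hβ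
    omega
  refine ⟨fun N hN t => torusIntegrable_rIntegrand hβ_pos ha hN t, fun c hc => ⟨?_,
    kontsevichLine_eq_kontsevichK hβ2 x hc⟩, ?_⟩
  · simp only [kontsevichIntegrand_verticalPoint]
    exact integrable_airyShift hβ2 x (by simpa using hc)
  obtain ⟨C, hC⟩ := norm_integral_scaled_sub_le hβ2 (a - 2 + 2 / β) x
  have hmt : Tendsto (fun N : ℕ => (2 * (N : ℝ)) ^ (1 / 3 : ℝ)) atTop atTop :=
    (tendsto_rpow_atTop (by norm_num)).comp
      (tendsto_natCast_atTop_atTop.const_mul_atTop (by norm_num))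
  refine Asymptotics.IsBigO.of_bound (C * 2 ^ (-(a * β + 4 / 3) - 1 / 3)) ?_
  filter_upwards [eventually_ge_atTop 2, hmt.eventually_ge_atTop 2,
    hmt.eventually_ge_atTop (2 * Real.pi ^ 2 * |x|)] with N hN hm2 hmx
  have hN0 : (0 : ℝ) < N := by exact_mod_cast (by omega : 0 < N)
  obtain ⟨m, hm⟩ : ∃ m, m = (2 * (N : ℝ)) ^ (1 / 3 : ℝ) := ⟨_, rfl⟩
  rw [← hm] at hm2 hmx ⊢
  have hm0 : 0 < m := by linarith
  have hm3 : m ^ 3 = 2 * N := by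
    rw [hm, ← Real.rpow_natCast, ← Real.rpow_mul (by positivity)]
    norm_num
  have hmsq : (2 * (N : ℝ)) ^ (2 / 3 : ℝ) = m ^ 2 := by
    rw [hm, ← Real.rpow_natCast, ← Real.rpow_mul (by positivity)]
    norm_num
  have hK : kontsevichK β x = 1 / (2 * (Real.pi : ℂ) * Complex.I) ^ β
      * (Complex.I ^ β * ∫ y, airyShift β x 1 y) := by
    rw [← kontsevichLine_eq_kontsevichK hβ2 x one_pos, kontsevichLine_eq, Complex.ofReal_one]
  rw [hmsq, rIntegral_eq_scaled hβ_pos ha hN hm0 hm3, saddle_constant_eq hβ_pos a x (by omega) hm,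
    hK]
  set A : ℝ := Real.exp (2 * β * N + β * m * x)
    / (2 ^ (a * β + 4 / 3) * (N : ℝ) ^ ((β : ℝ) - 2 / 3)) with hA
  have hA0 : 0 ≤ A := by positivity
  have h2pi : (2 * (Real.pi : ℂ) * Complex.I) ^ β ≠ 0 :=
    pow_ne_zero _ Complex.two_pi_I_ne_zero
  set J := ∫ y : Fin β → ℝ, (∏ j, scaledFactor m (a - 2 + 2 / β) x (y j))
    * (interaction β (fun j => (m : ℂ) * Complex.exp ((-y j / m : ℝ) * Complex.I)) : ℂ)
  set L := ∫ y, airyShift β x 1 y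
  have hdiff : Complex.I ^ β * (A : ℂ) * J - (2 * (Real.pi : ℂ) * Complex.I) ^ β * (A : ℂ)
      * (1 / (2 * (Real.pi : ℂ) * Complex.I) ^ β * (Complex.I ^ β * L))
      = Complex.I ^ β * (A : ℂ) * (J - L) := by
    generalize (2 * (Real.pi : ℂ) * Complex.I) ^ β = T at h2pi ⊢
    field_simp
  rw [hdiff, norm_mul, norm_mul, norm_pow, Complex.norm_I, one_pow, one_mul, Complex.norm_real,
    Real.norm_of_nonneg hA0, Real.norm_of_nonneg (by positivity)]
  have hminv : 1 / m = 2 ^ (-(1 / 3) : ℝ) * (N : ℝ) ^ (-(1 / 3) : ℝ) := by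
    rw [hm, ← Real.mul_rpow (by norm_num) hN0.le, Real.rpow_neg (by positivity), one_div]
  have hpow : (N : ℝ) ^ (-(β : ℝ) + 1 / 3)
      = ((N : ℝ) ^ ((β : ℝ) - 2 / 3))⁻¹ * (N : ℝ) ^ (-(1 / 3) : ℝ) := by
    rw [← Real.rpow_neg hN0.le, ← Real.rpow_add hN0]
    congr 1; ring
  have hpow2 : (2 : ℝ) ^ (-(a * β + 4 / 3) - 1 / 3)
      = (2 ^ (a * β + 4 / 3))⁻¹ * 2 ^ (-(1 / 3) : ℝ) := by
    rw [← Real.rpow_neg (by norm_num), ← Real.rpow_add (by norm_num)]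
    congr 1
  calc A * ‖J - L‖ ≤ A * (C * (1 / m)) := by
        gcongr
        exact hC m hm2 hmx
    _ = _ := by
        rw [hA, hminv, hpow, hpow2, div_eq_mul_inv, mul_inv]
        ring
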